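/- Let $n\ge 0$, $[n]=\{1,\dots,n\}$, and let $\mathfrak H_n$ be the group of signed permutations of $n$ points: the permutations $\sigma$ of $\pm[n]$ with $(-i).\sigma=-(i.\sigma)$. All maps act from the right. The sign $\operatorname{sgn}(\sigma)$ is the determinant of the monomial $\{0,\pm1\}$-matrix of $\sigma$. *Biwords.* A letter is a pair $(a,\epsilon)\in[n]\times\{-1,0,+1\}$ with radius $a$ and phase $\epsilon$, and $\overline{(a,\epsilon)}=(a,-\epsilon)$. A biword is a word $w=w_1\cdots w_n$ of letters, extended to $\pm[n]$ by $w_{-i}=\overline{w_i}$. The group $\mathfrak H_n$ acts on biwords by $(w.\sigma)_i=w_{i.\sigma^{-1}}$. Let $\lambda=(\lambda^{(0)},\lambda^{(1)})$ be a bipartition of $n$, i.e. a pair of partitions with $|\lambda^{(0)}|+|\lambda^{(1)}|=n$, and let $\lambda^t=((\lambda^{(1)})^t,(\lambda^{(0)})^t)$ be its transpose. The canonical biword $w_\lambda$ consists of $\lambda^{(0)}_1$ letters $(1,0)$, then $\lambda^{(0)}_2$ letters $(2,0)$, and so on, followed by $\lambda^{(1)}_1$ letters $(1,+1)$, then $\lambda^{(1)}_2$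 letters $(2,+1)$, and so on. Let $X_\lambda=w_\lambda.\mathfrak H_n$, let $V^\lambda$ be the permutation module over $\mathbb C$ with basis $X_\lambda$, and let $[\sigma]_{X_\lambda}^{X_\lambda}$ be the matrix of $\sigma$ on $V^\lambda$, whose row $x$ holds the coordinates of $x.\sigma$. *Bitableaus.* Consider pairs $(x,y)\in X_\lambda\times X_{\lambda^t}$ with unlike phases: for each $i\in[n]$ exactly one of $x_i,y_i$ has phase $0$. Let $F_\lambda$ be the set of those pairs whose stabilizer in $\mathfrak H_n$ is trivial. A pair $T=(x,y)\in F_\lambda$ is identified with the bitableau of shape $\lambda$ with components $T^{(01)}$ on the Young diagram of $\lambda^{(0)}$ and $T^{(10)}$ on that of $\lambda^{(1)}$: $T^{(01)}(a,b)$ is the unique $i\in\pm[n]$ with $x_i=(a,0)$, $y_i=(b,+1)$, and $T^{(10)}(a,b)$ is the unique $i\in\pm[n]$ with $x_i=(a,+1)$, $y_i=(b,0)$. Reading the rows of $T^{(01)}$ from top to bottom, then those of $T^{(10)}$, each from left to right, gives a signed permutation $T^\flat$ of $[n]$. The biword Specht matrix $M_\lambda=(m_{yx})$, with rows labelled by $y\in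 X_{\lambda^t}$ and columns by $x\in X_\lambda$, has entries $m_{yx}=\operatorname{sgn}((x,y)^\flat)$ if $(x,y)\in F_\lambda$, and $m_{yx}=0$ otherwise. *The module $S^\lambda$.* For a bitableau $T=(x,y)\in F_\lambda$ put $v_T=\operatorname{sgn}(T^\flat)\,x.c_y\in V^\lambda$, where $c_y=\sum_{\sigma}\operatorname{sgn}(\sigma)\,\sigma\in\mathbb C\mathfrak H_n$ is the sum over the stabilizer of $y$ in $\mathfrak H_n$. Let $S^\lambda$ be the span of all $v_T$, $T\in F_\lambda$. *Standard bitableaus.* A pair $T=(x,y)\in X_\lambda\times X_{\lambda^t}$ with unlike phases is called standard if all phases of $x$ and $y$ lie in $\{0,+1\}$ and, for all $i<j$ in $[n]$, if $x_i=x_j$ then the radius of $y_i$ is less than that of $y_j$, and if $y_i=y_j$ then the radius of $x_i$ is less than that of $x_j$. Then $T\in F_\lambda$. The standard pairs correspond to the standard bitableaus of shape $\lambda$; let $\mathrm{SYT}(\lambda)$ be their set. **Theorem.** Let $\lambda$ be a bipartition of $n$. The maps $(x,y)\mapsto x$ and $(x,y)\mapsto y$ are injective on $\mathrm{SYT}(\lambda)$;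 let $X_\lambda^\heartsuit$ and $X_{\lambda^t}^\heartsuit$ be their images. For a matrix $N$ with rows labelled by $X_{\lambda^t}$ and columns by $X_\lambda$, let $N^\heartsuit$ be its submatrix with rows in $X_{\lambda^t}^\heartsuit$ and columns in $X_\lambda^\heartsuit$, both labelled by $\mathrm{SYT}(\lambda)$. Then $M_\lambda^\heartsuit$ is invertible, $S^\lambda$ is an $\mathfrak H_n$-submodule of $V^\lambda$, the family $B_\lambda=(v_T)_{T\in\mathrm{SYT}(\lambda)}$ is a basis of $S^\lambda$, and for all $\sigma\in\mathfrak H_n$ the matrix $[\sigma]_{B_\lambda}^{B_\lambda}$ of $\sigma$ on $S^\lambda$, whose row $T$ holds the coordinates of $v_T.\sigma$ in $B_\lambda$, is $$[\sigma]_{B_\lambda}^{B_\lambda}=\bigl(M_\lambda\,[\sigma]_{X_\lambda}^{X_\lambda}\bigr)^{\heartsuit}\,\bigl(M_\lambda^{\heartsuit}\bigr)^{-1}.$$ -/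

import Mathlib

namespace Hyperoctahedral

/-! ### Signed permutations

The set `±[n]` is modelled as `Fin n × ℤˣ`: the pair `(i, 1)` is the point `i` and `(i, -1)` is the
point `-i` (points, rows and columns are numbered from `0`). -/

/-- The set `±[n]`. -/
abbrev SignedPoint (n : ℕ) : Type := Fin n × ℤˣ

/-- The negation `i ↦ -i` of `±[n]`. -/
def SignedPoint.bar {n : ℕ} (p : SignedPoint n) : SignedPoint n := (p.1, -p.2)

/-- The hyperoctahedral group: all permutations `σ` of `±[n]` with `σ (-i) = -σ(i)`. Multiplication
is composition of functions, the right factor being applied first. -/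
def H (n : ℕ) : Subgroup (Equiv.Perm (SignedPoint n)) where
  carrier := {σ | ∀ p, σ p.bar = (σ p).bar}
  one_mem' := fun _ => rfl
  mul_mem' := by
    intro σ τ hσ hτ p
    have h1 := hσ (τ p)
    have h2 := hτ p
    simp only [Equiv.Perm.coe_mul, Function.comp_apply]
    rw [h2, h1]
  inv_mem' := by
    intro σ hσ p
    change σ.symm p.bar = (σ.symm p).bar
    rw [Equiv.symm_apply_eq, hσ, Equiv.apply_symm_apply]

/-- The monomial matrix of a map `[n] → ±[n]`: row `i` has the sign of `f i` in column `|f i|`. -/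
def monomialMatrix {n : ℕ} (f : Fin n → SignedPoint n) : Matrix (Fin n) (Fin n) ℤ :=
  Matrix.of fun i j => if (f i).1 = j then ((f i).2 : ℤ) else 0

/-- The sign of a signed permutation, given as a map `[n] → ±[n]`: the determinant of its monomial
matrix. -/
def sgnFun {n : ℕ} (f : Fin n → SignedPoint n) : ℤ := (monomialMatrix f).det

/-- The sign of an element of the hyperoctahedral group. -/
def sgn {n : ℕ} (σ : H n) : ℤ := sgnFun fun i => σ.1 (i, 1)

/-! ### Biwords -/

/-- The alphabet `[n] × {-1, 0, +1}`; a letter is a pair `(radius, phase)`. -/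
abbrev Letter (n : ℕ) : Type := Fin n × SignType

/-- The bar involution on letters, which negates the phase. -/
def Letter.bar {n : ℕ} (l : Letter n) : Letter n := (l.1, -l.2)

/-- Biwords of length `n`. -/
def Biword (n : ℕ) : Type := Fin n → Letter n

instance (n : ℕ) : DecidableEq (Biword n) := inferInstanceAs (DecidableEq (Fin n → Letter n))

instance (n : ℕ) : Fintype (Biword n) := inferInstanceAs (Fintype (Fin n → Letter n))

/-- A biword regarded as a map on `±[n]`: the image of `-i` is the bar of the letter `w i`. -/
def Biword.ext {n : ℕ} (w : Biword n) (p : SignedPoint n) : Letter n :=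
  if p.2 = 1 then w p.1 else Letter.bar (w p.1)

/-- The biword `w.σ`, whose `i`-th letter is the image under `w` of the preimage of `i` under
`σ`. -/
def Biword.act {n : ℕ} (σ : H n) (w : Biword n) : Biword n := fun i => w.ext (σ⁻¹.1 (i, 1))

theorem Biword.ext_bar {n : ℕ} (w : Biword n) (p : SignedPoint n) :
    w.ext p.bar = Letter.bar (w.ext p) := by
  obtain ⟨i, ε⟩ := p
  rcases Int.units_eq_one_or ε with rfl | rfl
  · simp [Biword.ext, SignedPoint.bar]
  · simp [Biword.ext, SignedPoint.bar, Letter.bar]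

theorem Biword.ext_act {n : ℕ} (σ : H n) (w : Biword n) (p : SignedPoint n) :
    (w.act σ).ext p = w.ext (σ⁻¹.1 p) := by
  obtain ⟨i, ε⟩ := p
  rcases Int.units_eq_one_or ε with rfl | rfl
  · simp [Biword.ext, Biword.act]
  · have h : σ⁻¹.1 (i, -1) = (σ⁻¹.1 (i, 1)).bar := σ⁻¹.2 (i, 1)
    rw [h, Biword.ext_bar]
    simp [Biword.ext, Biword.act]

/-- The action of the hyperoctahedral group on biwords. As a left action it is `σ • w = w.σ`,
because the product `σ * τ` of `H n` applies `τ` first. -/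
instance (n : ℕ) : MulAction (H n) (Biword n) where
  smul := Biword.act
  one_smul w := by
    funext i
    change w.ext ((1 : H n)⁻¹.1 (i, 1)) = w i
    simp [Biword.ext]
  mul_smul σ τ w := by
    funext i
    change w.ext ((σ * τ)⁻¹.1 (i, 1)) = (w.act τ).ext (σ⁻¹.1 (i, 1))
    rw [Biword.ext_act]
    simp

/-! ### Bipartitions and canonical biwords -/

/-- A bipartition of `n`: a pair of partitions, given by their Young diagrams (so the parts of a
partition are the row lengths), of total size `n`. -/
structure Bipartition (n : ℕ) where
  zero : YoungDiagram
  one : YoungDiagram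
  card_add : zero.card + one.card = n

/-- The transpose of a bipartition: `(λ⁰, λ¹)ᵗ = ((λ¹)ᵗ, (λ⁰)ᵗ)`. -/
def Bipartition.transpose {n : ℕ} (lam : Bipartition n) : Bipartition n where
  zero := lam.one.transpose
  one := lam.zero.transpose
  card_add := by
    have h (μ : YoungDiagram) : μ.transpose.card = μ.card := by
      simp [YoungDiagram.card, YoungDiagram.transpose]
    rw [h, h, add_comm]
    exact lam.card_add

theorem sum_rowLen (μ : YoungDiagram) (n : ℕ) (h : μ.card ≤ n) :
    ∑ a : Fin n, μ.rowLen a = μ.card := by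
  have hmem : ∀ c ∈ μ.cells, c.1 ∈ Finset.range n := by
    intro c hc
    have h1 : c.1 < μ.colLen c.2 := YoungDiagram.mem_iff_lt_colLen.1 hc
    have h2 : μ.colLen c.2 ≤ μ.card := by
      rw [YoungDiagram.colLen_eq_card]
      exact Finset.card_le_card (Finset.filter_subset _ _)
    exact Finset.mem_range.2 (by omega)
  rw [Fin.sum_univ_eq_sum_range (fun a => μ.rowLen a) n, YoungDiagram.card,
    Finset.card_eq_sum_card_fiberwise hmem]
  exact Finset.sum_congr rfl fun a _ => YoungDiagram.rowLen_eq_card μ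

/-- The word obtained by reading the cells `(a, b)` of a Young diagram row by row, from top to bottom
and within each row from left to right, and writing `f a b` for the cell `(a, b)`. -/
def readRows {α : Type} {n : ℕ} (μ : YoungDiagram) (f : Fin n → Fin n → α) : List α :=
  (List.finRange n).flatMap fun a =>
    ((List.finRange n).filter fun b => b.val < μ.rowLen a.val).map fun b => f a b

theorem length_readRows {α : Type} {n : ℕ} (μ : YoungDiagram) (h : μ.card ≤ n)
    (f : Fin n → Fin n → α) : (readRows μ f).length = μ.card := by
  have hrow : ∀ a : ℕ, μ.rowLen a ≤ n := by
    intro a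
    rw [YoungDiagram.rowLen_eq_card]
    exact (Finset.card_le_card (Finset.filter_subset _ _)).trans h
  have hlen : ∀ a : Fin n,
      ((List.finRange n).filter fun b => b.val < μ.rowLen a.val).length = μ.rowLen a := by
    intro a
    have h1 : ((List.finRange n).filter fun b => b.val < μ.rowLen a.val).length =
        (Finset.univ.filter fun b : Fin n => b.val < μ.rowLen a.val).card := by
      rw [← List.toFinset_card_of_nodup ((List.nodup_finRange n).filter _)]
      congr 1
      ext b
      simp
    rw [h1, Fin.card_filter_val_lt, min_eq_right (hrow a)]
  rw [← sum_rowLen μ n h, readRows, List.length_flatMap, ← List.ofFn_id, List.map_ofFn,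
    List.sum_ofFn]
  refine Finset.sum_congr rfl fun a _ => ?_
  rw [List.ofFn_id]
  simpa using hlen a

/-- The canonical biword of shape `lam`, as a list: the canonical word `1 ⋯ 1 2 ⋯ 2 ⋯` of `λ⁰`
with all phases `0`, followed by the canonical word of `λ¹` with all phases `+1`. -/
def Bipartition.wordList {n : ℕ} (lam : Bipartition n) : List (Letter n) :=
  readRows lam.zero (fun a _ => (a, 0)) ++ readRows lam.one (fun a _ => (a, 1))

theorem Bipartition.length_wordList {n : ℕ} (lam : Bipartition n) : lam.wordList.length = n := by
  have h := lam.card_add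
  rw [wordList, List.length_append, length_readRows _ (by omega), length_readRows _ (by omega), h]

/-- The canonical biword of shape `lam`. -/
def Bipartition.word {n : ℕ} (lam : Bipartition n) : Biword n :=
  fun i => lam.wordList.get (i.cast lam.length_wordList.symm)

/-- The set `X_λ` of all signed rearrangements of the canonical biword of shape `lam`. -/
abbrev X {n : ℕ} (lam : Bipartition n) : Type := MulAction.orbit (H n) lam.word

noncomputable instance {n : ℕ} (lam : Bipartition n) : Fintype (X lam) := Fintype.ofFinite _

/-! ### Pairs of biwords and bitableaus -/

/-- The pairs of biwords with unlike phases: in each column exactly one of the two phases is `0`. -/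
def Unlike {n : ℕ} (x y : Biword n) : Prop := ∀ i, Xor ((x i).2 = 0) ((y i).2 = 0)

/-- The free component of the set of pairs of biwords with unlike phases: the pairs whose stabilizer
in the hyperoctahedral group is trivial. -/
def Free {n : ℕ} (x y : Biword n) : Prop :=
  Unlike x y ∧ MulAction.stabilizer (H n) ((x, y) : Biword n × Biword n) = ⊥

/-- The columns of letters that belong to the cells of the Young bidiagram of `lam`, in reading
order: a cell `(a, b)` of `λ⁰` gives the column `((a, 0), (b, 1))` and a cell `(a, b)` of `λ¹` gives
the column `((a, 1), (b, 0))`. -/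
def Bipartition.columnList {n : ℕ} (lam : Bipartition n) : List (Letter n × Letter n) :=
  readRows lam.zero (fun a b => ((a, 0), (b, 1))) ++
    readRows lam.one (fun a b => ((a, 1), (b, 0)))

theorem Bipartition.length_columnList {n : ℕ} (lam : Bipartition n) :
    lam.columnList.length = n := by
  have h := lam.card_add
  rw [columnList, List.length_append, length_readRows _ (by omega), length_readRows _ (by omega), h]

/-- The column of letters that belongs to the `k`-th cell of the Young bidiagram of `lam`. -/
def Bipartition.column {n : ℕ} (lam : Bipartition n) (k : Fin n) : Letter n × Letter n :=
  lam.columnList.get (k.cast lam.length_columnList.symm)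

/-- The entries of the bitableau `T` of shape `lam` that is given by the pair of biwords `(x, y)`,
in reading order (first the rows of the component on `λ⁰`, then those of the component on `λ¹`). The
entry in a cell is the point of `±[n]` at which the column of the pair `(x, y)` is the one belonging
to the cell; for pairs in the free component of `X_λ` and `X_{λᵗ}` this point exists and is
unique. -/
noncomputable def flat {n : ℕ} (lam : Bipartition n) (x y : Biword n) (k : Fin n) : SignedPoint n :=
  haveI : Nonempty (SignedPoint n) := ⟨(k, 1)⟩
  Function.invFun (fun p : SignedPoint n => (x.ext p, y.ext p)) (lam.column k)

open scoped Classical in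
/-- The biword Specht matrix `M_λ`, with rows labelled by `X_{λᵗ}` and columns by `X_λ`. -/
noncomputable def spechtMatrix {n : ℕ} (lam : Bipartition n) :
    Matrix (X lam.transpose) (X lam) ℂ :=
  Matrix.of fun y x => if Free x.1 y.1 then (sgnFun (flat lam x.1 y.1) : ℂ) else 0

/-! ### The permutation module and its submodule -/

/-- The permutation module `V^λ` with basis `X_λ`. -/
abbrev V {n : ℕ} (lam : Bipartition n) : Type := X lam →₀ ℂ

/-- The action of the hyperoctahedral group on `V^λ`: it permutes the basis `X_λ`. -/
noncomputable def rho {n : ℕ} (lam : Bipartition n) : Representation ℂ (H n) (V lam) where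
  toFun σ := Finsupp.lmapDomain ℂ ℂ (fun x : X lam => σ • x)
  map_one' := by
    ext x : 2
    simp
  map_mul' σ τ := by
    ext x : 2
    simp [mul_smul]

/-- The matrix of `σ` on `V^λ` in the basis `X_λ`. Group elements act on row vectors, so the
row of `x` holds the coordinates of the image of `x`. -/
noncomputable def permMatrix {n : ℕ} (lam : Bipartition n) (σ : H n) : Matrix (X lam) (X lam) ℂ :=
  Matrix.of fun x x' => rho lam σ (Finsupp.single x 1) x'

noncomputable instance (n : ℕ) : Fintype (H n) := Fintype.ofFinite _

/-- The signed sum `c_y` of the elements of the stabilizer of the biword `y`, in the group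
algebra. -/
noncomputable def colSum {n : ℕ} (y : Biword n) : MonoidAlgebra ℂ (H n) :=
  ∑ σ : H n with σ • y = y, MonoidAlgebra.single σ (sgn σ : ℂ)

/-- The vector `v_T = sgn(T) x.c_y` of the bitableau `T` given by the pair of biwords `(x, y)`. -/
noncomputable def spechtVector {n : ℕ} (lam : Bipartition n) (x : X lam) (y : X lam.transpose) :
    V lam :=
  (sgnFun (flat lam x.1 y.1) : ℂ) • (rho lam).asAlgebraHom (colSum y.1) (Finsupp.single x 1)

/-- The module `S^λ`: the span of the vectors `v_T` of all bitableaus `T` of shape `lam`. -/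
noncomputable def S {n : ℕ} (lam : Bipartition n) : Submodule ℂ (V lam) :=
  Submodule.span ℂ {v | ∃ (x : X lam) (y : X lam.transpose),
    Free x.1 y.1 ∧ spechtVector lam x y = v}

/-! ### Standard bitableaus -/

/-- Standard pairs of biwords: the phases are unlike and lie in `{0, +1}`, and each of the two words
is strictly increasing in radius on the positions in `[n]` at which the other one has a given
letter. -/
structure IsStandard {n : ℕ} (x y : Biword n) : Prop where
  unlike : Unlike x y
  left_nonneg : ∀ i, 0 ≤ (x i).2
  right_nonneg : ∀ i, 0 ≤ (y i).2
  right_increasing : ∀ i j, i < j → x i = x j → (y i).1 < (y j).1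
  left_increasing : ∀ i j, i < j → y i = y j → (x i).1 < (x j).1

/-- The standard bitableaus of shape `lam`, as standard pairs of biwords. -/
def SYT {n : ℕ} (lam : Bipartition n) : Type :=
  {T : X lam × X lam.transpose // IsStandard T.1.1 T.2.1}

/-- The first word of a standard bitableau. -/
def SYT.x {n : ℕ} {lam : Bipartition n} (T : SYT lam) : X lam := T.1.1

/-- The second word of a standard bitableau. -/
def SYT.y {n : ℕ} {lam : Bipartition n} (T : SYT lam) : X lam.transpose := T.1.2

noncomputable instance {n : ℕ} (lam : Bipartition n) : Fintype (SYT lam) :=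
  haveI : Finite (SYT lam) := Subtype.finite
  Fintype.ofFinite _

noncomputable instance {n : ℕ} (lam : Bipartition n) : DecidableEq (SYT lam) := Classical.decEq _

/-- The submatrix on the rows in `X_{λᵗ}^♡` and the columns in `X_λ^♡`, that is, on the second words
and the first words of the standard bitableaus; both are labelled by the standard bitableaus. -/
def heart {n : ℕ} {lam : Bipartition n} (M : Matrix (X lam.transpose) (X lam) ℂ) :
    Matrix (SYT lam) (SYT lam) ℂ :=
  M.submatrix SYT.y SYT.x

end Hyperoctahedral

/-!
The columns of a pair `(x, y)` are the pairs of letters `(x p, y p)`, `p ∈ ±[n]`. A pair with unlike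
phases is free precisely when its columns are distinct (`free_iff`), and for `x ∈ X_λ`, `y ∈ X_{λᵗ}`
the columns then fill exactly the cells of the bidiagram, because a set of cells with the row and
column lengths of a Young diagram is the diagram (`Free.fills`). So the free pairs form one regular
orbit. It follows that the Specht matrix `M` is equivariant up to the sign character
(`spechtMatrix_smul`), that its nonzero entries are the free ones, and that `v_T` is the row `y` of
`M` for each `T = (x, y)` (`spechtVector_apply`). Thus `S^λ` is the row space of `M`, and everything
is a statement about rows of `M`.

If `(x, y)` is standard and `(x', y)` is free with nonnegative phases, then `x` is lexicographically
at most `x'` (`IsStandard.toLex_rad_le`). This gives the two injectivity claims, and it makes `M^♡`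
triangular with diagonal entries `±1`, hence invertible (`isUnit_heart_spechtMatrix`); in particular
the rows of the standard pairs are independent. They span by straightening. A sign change at `i`
multiplies a row by `±1`, so only nonnegative phases matter. A word `y` without standard partner has a
descent (`exists_standard_or_descent`): the `a`-th occurrence of a letter precedes the `a`-th
occurrence of a letter of smaller radius and the same phase. In terms of words the Garnir relation at
a descent reads: the rows of all rearrangements of `y` within a certain set of positions add up to
zero (`sum_spechtMatrix_eq_zero`). All rearrangements other than `y` are lexicographically smaller, so
induction applies (`spechtRow_mem_span_of_nonneg`).

Finally `v_T.σ` is the row `y` of `M [σ]`. Comparing the coefficients of `v_T.σ = ∑ N_{TU} v_U` at the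
first words of the standard pairs gives `(M [σ])^♡ = N M^♡` (`toMatrix_transpose_mul_heart`).
-/

namespace Hyperoctahedral

/-! ### Signed permutations and their sign -/

theorem SignedPoint.bar_bar {n : ℕ} (p : SignedPoint n) : p.bar.bar = p := by
  simp [SignedPoint.bar]

/-- The signed permutation `i ↦ s i · π i`. -/
def signedPerm {n : ℕ} (π : Equiv.Perm (Fin n)) (s : Fin n → ℤˣ) : H n where
  val :=
    { toFun := fun p => (π p.1, s p.1 * p.2)
      invFun := fun p => (π.symm p.1, s (π.symm p.1) * p.2)
      left_inv := fun p => by simp [← mul_assoc]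
      right_inv := fun p => by simp [← mul_assoc] }
  property := fun p => by simp [SignedPoint.bar]

@[simp] theorem signedPerm_apply {n : ℕ} (π : Equiv.Perm (Fin n)) (s : Fin n → ℤˣ)
    (p : SignedPoint n) : (signedPerm π s).1 p = (π p.1, s p.1 * p.2) := rfl

theorem H.apply_neg {n : ℕ} (σ : H n) (i : Fin n) : σ.1 (i, -1) = (σ.1 (i, 1)).bar := σ.2 (i, 1)

theorem H.ext_one {n : ℕ} {σ τ : H n} (h : ∀ i, σ.1 (i, 1) = τ.1 (i, 1)) : σ = τ := by
  apply Subtype.ext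
  ext1 ⟨i, ε⟩
  rcases Int.units_eq_one_or ε with rfl | rfl
  · exact h i
  · rw [H.apply_neg, H.apply_neg, h]

/-- The sign of a signed permutation is multiplicative. -/
theorem sgnFun_comp {n : ℕ} (σ : H n) (f : Fin n → SignedPoint n) :
    sgnFun (fun i => σ.1 (f i)) = sgn σ * sgnFun f := by
  have h : monomialMatrix (fun i => σ.1 (f i)) =
      monomialMatrix f * monomialMatrix fun i => σ.1 (i, 1) := by
    ext i j
    rw [Matrix.mul_apply, Finset.sum_eq_single (f i).1]
    · rcases hf : f i with ⟨k, ε⟩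
      rcases Int.units_eq_one_or ε with rfl | rfl
      · simp [monomialMatrix, hf]
      · simp [monomialMatrix, hf, H.apply_neg, SignedPoint.bar]
    · intro b _ hb
      simp [monomialMatrix, Ne.symm hb]
    · simp
  rw [sgn, sgnFun, h, Matrix.det_mul, mul_comm]
  rfl

theorem sgn_mul {n : ℕ} (σ τ : H n) : sgn (σ * τ) = sgn σ * sgn τ :=
  sgnFun_comp σ fun i => τ.1 (i, 1)

theorem sgn_signedPerm {n : ℕ} (π : Equiv.Perm (Fin n)) (s : Fin n → ℤˣ) :
    sgn (signedPerm π s) = Equiv.Perm.sign π * ∏ i, (s i : ℤ) := by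
  have h : monomialMatrix (fun i => (signedPerm π s).1 (i, 1)) =
      Matrix.diagonal (fun i => (s i : ℤ)) * π.permMatrix ℤ := by
    ext i j
    simp [monomialMatrix, Equiv.Perm.permMatrix, PEquiv.toMatrix_apply, eq_comm]
  rw [sgn, sgnFun, h, Matrix.det_mul, Matrix.det_diagonal, Matrix.det_permutation, mul_comm]
  simp

theorem sgn_one {n : ℕ} : sgn (1 : H n) = 1 := by
  have h : signedPerm (1 : Equiv.Perm (Fin n)) 1 = 1 := H.ext_one fun i => by simp
  rw [← h, sgn_signedPerm]
  simp

theorem sgn_ne_zero {n : ℕ} (σ : H n) : sgn σ ≠ 0 := by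
  intro h
  have := sgn_mul σ σ⁻¹
  rw [mul_inv_cancel, sgn_one, h] at this
  simp at this

/-! ### Biwords and the columns of a pair of biwords -/

theorem Letter.bar_bar {n : ℕ} (l : Letter n) : l.bar.bar = l := by simp [Letter.bar]

@[simp] theorem Biword.ext_pos {n : ℕ} (w : Biword n) (i : Fin n) : w.ext (i, 1) = w i := by
  simp [Biword.ext]

@[simp] theorem Biword.ext_neg {n : ℕ} (w : Biword n) (i : Fin n) :
    w.ext (i, -1) = (w i).bar := by
  simp [Biword.ext]

theorem Biword.ext_smul {n : ℕ} (σ : H n) (w : Biword n) (p : SignedPoint n) :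
    (σ • w).ext p = w.ext (σ⁻¹.1 p) := Biword.ext_act σ w p

theorem Biword.ext_smul_apply {n : ℕ} (σ : H n) (w : Biword n) (p : SignedPoint n) :
    (σ • w).ext (σ.1 p) = w.ext p := by
  rw [Biword.ext_smul]
  simp

theorem Biword.smul_eq_of_ext {n : ℕ} {σ : H n} {w w' : Biword n}
    (h : ∀ i, w'.ext (σ.1 (i, 1)) = w i) : σ • w = w' := by
  rw [← eq_inv_smul_iff]
  funext i
  rw [← h i, ← Biword.ext_smul_apply σ⁻¹ w']
  simp

/-- The columns of a pair of biwords, as a map on `±[n]`. -/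
def columns {n : ℕ} (x y : Biword n) (p : SignedPoint n) : Letter n × Letter n :=
  (x.ext p, y.ext p)

theorem columns_bar_eq_iff {n : ℕ} {x y x' y' : Biword n} {p q : SignedPoint n} :
    columns x y p.bar = columns x' y' q.bar ↔ columns x y p = columns x' y' q := by
  have h (l l' : Letter n) : l.bar = l'.bar ↔ l = l' :=
    ⟨fun h => by rw [← l.bar_bar, h, l'.bar_bar], fun h => by rw [h]⟩
  simp [columns, Biword.ext_bar, h]

theorem columns_smul {n : ℕ} (σ : H n) (x y : Biword n) (p : SignedPoint n) :
    columns (σ • x) (σ • y) (σ.1 p) = columns x y p := by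
  simp [columns, Biword.ext_smul_apply]

theorem Unlike.swap {n : ℕ} {x y : Biword n} (h : Unlike x y) : Unlike y x :=
  fun i => (h i).symm

theorem Unlike.left_eq_zero_iff {n : ℕ} {x y : Biword n} (h : Unlike x y) (i : Fin n) :
    (x i).2 = 0 ↔ (y i).2 ≠ 0 := by
  have := h i
  unfold Xor at this
  tauto

theorem Unlike.columns_bar_ne {n : ℕ} {x y : Biword n} (h : Unlike x y) (p : SignedPoint n) :
    columns x y p.bar ≠ columns x y p := by
  have key (l : Letter n) (hl : l.bar = l) : l.2 = 0 := by
    have := congrArg Prod.snd hl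
    simpa [Letter.bar, SignType.neg_eq_self_iff] using this
  intro e
  have e1 : columns x y (p.1, -1) = columns x y (p.1, 1) := by
    obtain ⟨i, ε⟩ := p
    rcases Int.units_eq_one_or ε with rfl | rfl
    · exact e
    · simpa [SignedPoint.bar] using e.symm
  simp only [columns, Biword.ext_pos, Biword.ext_neg, Prod.mk.injEq] at e1
  exact (h.left_eq_zero_iff p.1).1 (key _ e1.1) (key _ e1.2)

/-- A pair of biwords with unlike phases has trivial stabilizer precisely when its columns are
pairwise distinct on `±[n]`: two equal columns are exchanged by a signed transposition. -/
theorem free_iff {n : ℕ} {x y : Biword n} :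
    Free x y ↔ Unlike x y ∧ Function.Injective (columns x y) := by
  constructor
  · rintro ⟨hu, hs⟩
    refine ⟨hu, fun p q hpq => ?_⟩
    obtain ⟨i, ε⟩ := p
    obtain ⟨j, η⟩ := q
    by_cases hij : i = j
    · subst hij
      by_contra hne
      apply hu.columns_bar_ne (i, ε)
      rw [hpq]
      congr 1
      have : ε ≠ η := fun h => hne (by rw [h])
      simp only [SignedPoint.bar, Prod.mk.injEq, true_and]
      rcases Int.units_eq_one_or ε with rfl | rfl <;>
        rcases Int.units_eq_one_or η with rfl | rfl <;> simp_all
    · exfalso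
      have hcol : columns x y (j, ε * η) = columns x y (i, 1) ∧
          columns x y (i, ε * η) = columns x y (j, 1) := by
        rcases Int.units_eq_one_or ε with rfl | rfl <;>
          rcases Int.units_eq_one_or η with rfl | rfl
        · exact ⟨hpq.symm, hpq⟩
        · exact ⟨by simpa using hpq.symm,
            columns_bar_eq_iff.1 (by simpa [SignedPoint.bar] using hpq)⟩
        · exact ⟨columns_bar_eq_iff.1 (by simpa [SignedPoint.bar] using hpq.symm),
            by simpa using hpq⟩
        · exact ⟨columns_bar_eq_iff.1 (by simpa [SignedPoint.bar] using hpq.symm),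
            columns_bar_eq_iff.1 (by simpa [SignedPoint.bar] using hpq)⟩
      set σ : H n := signedPerm (Equiv.swap i j)
        (fun k => if k = i ∨ k = j then ε * η else 1) with hσ
      have hfix : ∀ k, columns x y (σ.1 (k, 1)) = columns x y (k, 1) := by
        intro k
        rw [hσ, signedPerm_apply]
        by_cases hki : k = i
        · subst hki
          simpa using hcol.1
        · by_cases hkj : k = j
          · subst hkj
            simpa using hcol.2
          · simp [hki, hkj, Equiv.swap_apply_of_ne_of_ne hki hkj]
      have hmem : σ ∈ MulAction.stabilizer (H n) ((x, y) : Biword n × Biword n) := by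
        rw [MulAction.mem_stabilizer_iff, Prod.smul_mk, Prod.mk.injEq]
        exact ⟨Biword.smul_eq_of_ext fun k => (congrArg Prod.fst (hfix k)).trans (x.ext_pos k),
          Biword.smul_eq_of_ext fun k => (congrArg Prod.snd (hfix k)).trans (y.ext_pos k)⟩
      rw [hs, Subgroup.mem_bot] at hmem
      have := congrArg (fun τ : H n => (τ.1 (i, 1)).1) hmem
      simp [hσ] at this
      exact hij this.symm
  · rintro ⟨hu, hinj⟩
    refine ⟨hu, (Subgroup.eq_bot_iff_forall _).2 fun σ hσ => ?_⟩
    rw [MulAction.mem_stabilizer_iff, Prod.smul_mk, Prod.mk.injEq] at hσ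
    refine H.ext_one fun i => hinj ?_
    have := columns_smul σ x y (i, 1)
    rw [hσ.1, hσ.2] at this
    exact this

theorem Unlike.smul {n : ℕ} {x y : Biword n} (h : Unlike x y) (σ : H n) :
    Unlike (σ • x) (σ • y) := by
  intro i
  have h0 (w : Biword n) : ((σ • w) i).2 = 0 ↔ (w (σ⁻¹.1 (i, 1)).1).2 = 0 := by
    rw [← Biword.ext_pos (σ • w), Biword.ext_smul]
    simp only [Biword.ext]
    split_ifs <;> simp [Letter.bar]
  rw [h0, h0]
  exact h _

theorem Free.smul {n : ℕ} {x y : Biword n} (h : Free x y) (σ : H n) :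
    Free (σ • x) (σ • y) := by
  rw [free_iff] at h ⊢
  refine ⟨h.1.smul σ, fun p q hpq => ?_⟩
  have h1 := columns_smul σ x y (σ⁻¹.1 p)
  have h2 := columns_smul σ x y (σ⁻¹.1 q)
  have := h.2 (h1.symm.trans (by simpa using hpq) |>.trans h2)
  exact (σ⁻¹.1).injective this

theorem free_smul_iff {n : ℕ} {x y : Biword n} (σ : H n) :
    Free (σ • x) (σ • y) ↔ Free x y :=
  ⟨fun h => by simpa using h.smul σ⁻¹, fun h => h.smul σ⟩


/-! ### A Young diagram is determined by its row and column lengths -/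

/-- A finite set of cells whose rows are as long as those of a Young diagram, and which has as many
cells in the first `c` columns for each `c`, lies in the diagram: it has at most
`min (rowLen a) c` cells in row `a` and the first `c` columns, and the diagram attains each of these
bounds. -/
theorem mem_youngDiagram_of_card_eq (μ : YoungDiagram) (A : Finset (ℕ × ℕ))
    (hrow : ∀ a, (A.filter fun c => c.1 = a).card = μ.rowLen a)
    (hcol : ∀ b, (A.filter fun c => c.2 = b).card = μ.colLen b) {c : ℕ × ℕ} (hc : c ∈ A) :
    c ∈ μ := by
  set N := μ.rowLen c.1 with hN
  -- the number of cells in the first `N` columns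
  have hcols (B : Finset (ℕ × ℕ)) : (B.filter fun c => c.2 < N).card =
      ∑ b ∈ Finset.range N, (B.filter fun c => c.2 = b).card := by
    rw [Finset.card_eq_sum_card_fiberwise (f := Prod.snd) (t := Finset.range N)]
    · refine Finset.sum_congr rfl fun b hb => ?_
      rw [Finset.filter_filter]
      congr 1
      ext d
      simp only [Finset.mem_filter, Finset.mem_range] at hb ⊢
      constructor
      · tauto
      · rintro ⟨h1, rfl⟩
        exact ⟨h1, hb, rfl⟩
    · intro d hd
      simpa using (Finset.mem_filter.1 hd).2
  set K := (A ∪ μ.cells).image Prod.fst with hK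
  have hrows (B : Finset (ℕ × ℕ)) (hB : B ⊆ A ∪ μ.cells) : (B.filter fun c => c.2 < N).card =
      ∑ a ∈ K, (B.filter fun c => c.1 = a ∧ c.2 < N).card := by
    rw [Finset.card_eq_sum_card_fiberwise (f := Prod.fst) (t := K)]
    · refine Finset.sum_congr rfl fun a _ => ?_
      rw [Finset.filter_filter]
      congr 1
      ext d
      simp [and_comm]
    · intro d hd
      exact Finset.mem_image_of_mem _ (hB (Finset.mem_filter.1 hd).1)
  have hμ (a : ℕ) : (μ.cells.filter fun c => c.1 = a ∧ c.2 < N).card = min (μ.rowLen a) N := by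
    have : (μ.cells.filter fun c => c.1 = a ∧ c.2 < N) =
        {a} ×ˢ Finset.range (min (μ.rowLen a) N) := by
      ext ⟨i, j⟩
      simp only [Finset.mem_filter, YoungDiagram.mem_cells, YoungDiagram.mem_iff_lt_rowLen,
        Finset.mem_product, Finset.mem_singleton, Finset.mem_range, lt_min_iff]
      constructor
      · rintro ⟨h1, rfl, h3⟩
        exact ⟨rfl, h1, h3⟩
      · rintro ⟨rfl, h1, h3⟩
        exact ⟨h1, rfl, h3⟩
    rw [this, Finset.card_product]
    simp
  have hA (a : ℕ) : (A.filter fun c => c.1 = a ∧ c.2 < N).card ≤ min (μ.rowLen a) N := by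
    refine le_min ?_ ?_
    · rw [← hrow a]
      exact Finset.card_le_card fun d hd => by
        simp only [Finset.mem_filter] at hd ⊢
        exact ⟨hd.1, hd.2.1⟩
    · calc _ ≤ (({a} : Finset ℕ) ×ˢ Finset.range N).card := Finset.card_le_card fun d hd => by
            simp only [Finset.mem_filter] at hd
            rw [Finset.mem_product, Finset.mem_singleton, Finset.mem_range]
            exact hd.2
        _ = N := by simp
  have htot : ∑ a ∈ K, (A.filter fun c => c.1 = a ∧ c.2 < N).card =
      ∑ a ∈ K, min (μ.rowLen a) N := by
    rw [← hrows A Finset.subset_union_left, hcols A]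
    simp_rw [← hμ]
    rw [← hrows μ.cells Finset.subset_union_right, hcols μ.cells]
    refine Finset.sum_congr rfl fun b _ => ?_
    rw [hcol, YoungDiagram.colLen_eq_card]
    rfl
  have heq := (Finset.sum_eq_sum_iff_of_le fun a _ => hA a).1 htot c.1
    (Finset.mem_image_of_mem _ (Finset.mem_union_left _ hc))
  rw [← hN, min_self] at heq
  replace heq := heq.trans (hN.trans (hrow c.1).symm)
  have hsub := Finset.eq_of_subset_of_card_le (fun d hd => by
    simp only [Finset.mem_filter] at hd ⊢
    exact ⟨hd.1, hd.2.1⟩ :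
      (A.filter fun d => d.1 = c.1 ∧ d.2 < N) ⊆ A.filter fun d => d.1 = c.1) heq.ge
  have hmem : c ∈ A.filter fun d => d.1 = c.1 := by simpa using hc
  rw [← hsub] at hmem
  exact YoungDiagram.mem_iff_lt_rowLen.2 (Finset.mem_filter.1 hmem).2.2

/-! ### The content of a biword -/

/-- The component of a bipartition on which the letters of phase zero (`z = true`) respectively of
nonzero phase (`z = false`) of the first word are placed. -/
def Bipartition.shape {n : ℕ} (lam : Bipartition n) (z : Bool) : YoungDiagram :=
  if z then lam.zero else lam.one

theorem Bipartition.shape_transpose {n : ℕ} (lam : Bipartition n) (z : Bool) :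
    lam.transpose.shape z = (lam.shape !z).transpose := by
  cases z <;> rfl

theorem Bipartition.card_shape_le {n : ℕ} (lam : Bipartition n) (z : Bool) :
    (lam.shape z).card ≤ n := by
  have := lam.card_add
  cases z
  · exact (by omega : lam.one.card ≤ n)
  · exact (by omega : lam.zero.card ≤ n)

theorem rowLen_le_card (μ : YoungDiagram) (a : ℕ) : μ.rowLen a ≤ μ.card := by
  rw [YoungDiagram.rowLen_eq_card]
  exact Finset.card_le_card (Finset.filter_subset _ _)

theorem colLen_le_card (μ : YoungDiagram) (b : ℕ) : μ.colLen b ≤ μ.card := by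
  rw [YoungDiagram.colLen_eq_card]
  exact Finset.card_le_card (Finset.filter_subset _ _)

theorem Bipartition.lt_of_mem_shape {n : ℕ} (lam : Bipartition n) {z : Bool} {a b : ℕ}
    (h : (a, b) ∈ lam.shape z) : a < n ∧ b < n := by
  have h1 := YoungDiagram.mem_iff_lt_rowLen.1 h
  have h2 := YoungDiagram.mem_iff_lt_colLen.1 h
  have h3 := rowLen_le_card (lam.shape z) a
  have h4 := colLen_le_card (lam.shape z) b
  have h5 := lam.card_shape_le z
  omega

/-- The letter of `w` at position `i`. -/
def Biword.letter {n : ℕ} (w : Biword n) (i : Fin n) : Letter n := w i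

/-- The radius of the letter of `w` at position `i`. -/
def Biword.rad {n : ℕ} (w : Biword n) (i : Fin n) : Fin n := (w.letter i).1

/-- The phase of the letter of `w` at position `i`. -/
def Biword.phase {n : ℕ} (w : Biword n) (i : Fin n) : SignType := (w.letter i).2

/-- The kind of the letter of `w` at position `i`: whether its phase is zero. -/
def Biword.kind {n : ℕ} (w : Biword n) (i : Fin n) : Bool := decide (w.phase i = 0)

theorem Unlike.kind_right {n : ℕ} {x y : Biword n} (h : Unlike x y) (i : Fin n) :
    y.kind i = !x.kind i := by
  have h1 : x.phase i = 0 ↔ y.phase i ≠ 0 := h.left_eq_zero_iff i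
  by_cases h0 : y.phase i = 0 <;> simp_all [Biword.kind]

theorem unlike_of_kind {n : ℕ} {x y : Biword n} (h : ∀ i, y.kind i = !x.kind i) :
    Unlike x y := by
  intro i
  have := h i
  change Xor (x.phase i = 0) (y.phase i = 0)
  unfold Xor
  by_cases h0 : y.phase i = 0 <;> by_cases h1 : x.phase i = 0 <;> simp_all [Biword.kind]

theorem Biword.rad_kind_smul {n : ℕ} (σ : H n) (w : Biword n) (i : Fin n) :
    (σ • w).rad i = w.rad (σ⁻¹.1 (i, 1)).1 ∧
      (σ • w).kind i = w.kind (σ⁻¹.1 (i, 1)).1 := by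
  have h : (σ • w).letter i = w.ext (σ⁻¹.1 (i, 1)) :=
    (Biword.ext_pos (σ • w) i).symm.trans (Biword.ext_smul σ w _)
  rw [Biword.kind, Biword.phase, Biword.rad, h]
  simp only [Biword.ext]
  split_ifs
  · exact ⟨rfl, rfl⟩
  · simp only [Letter.bar, SignType.neg_eq_zero_iff]
    exact ⟨rfl, rfl⟩

/-- The number of letters of given radius and kind in a biword. -/
def Biword.content {n : ℕ} (w : Biword n) (z : Bool) (a : Fin n) : ℕ :=
  (Finset.univ.filter fun i => w.rad i = a ∧ w.kind i = z).card

/-- The permutation of `[n]` that underlies a signed permutation. -/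
def H.toPerm {n : ℕ} (σ : H n) : Equiv.Perm (Fin n) where
  toFun i := (σ.1 (i, 1)).1
  invFun i := (σ⁻¹.1 (i, 1)).1
  left_inv i := by
    rcases h : σ.1 (i, 1) with ⟨j, ε⟩
    have h1 : σ⁻¹.1 (j, ε) = (i, 1) := by rw [← h]; simp
    change (σ⁻¹.1 ((σ.1 (i, 1)).1, 1)).1 = i
    rw [h]
    rcases Int.units_eq_one_or ε with rfl | rfl
    · exact congrArg Prod.fst h1
    · rw [H.apply_neg] at h1
      simpa [SignedPoint.bar] using congrArg Prod.fst h1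
  right_inv i := by
    rcases h : σ⁻¹.1 (i, 1) with ⟨j, ε⟩
    have h1 : σ.1 (j, ε) = (i, 1) := by rw [← h]; simp
    change (σ.1 ((σ⁻¹.1 (i, 1)).1, 1)).1 = i
    rw [h]
    rcases Int.units_eq_one_or ε with rfl | rfl
    · exact congrArg Prod.fst h1
    · rw [H.apply_neg] at h1
      simpa [SignedPoint.bar] using congrArg Prod.fst h1

theorem Biword.content_smul {n : ℕ} (σ : H n) (w : Biword n) (z : Bool) (a : Fin n) :
    (σ • w).content z a = w.content z a := by
  refine Finset.card_equiv (H.toPerm σ⁻¹) fun i => ?_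
  simp only [Finset.mem_filter, Finset.mem_univ, true_and]
  rw [(Biword.rad_kind_smul σ w i).1, (Biword.rad_kind_smul σ w i).2]
  rfl

theorem length_filter_finRange {n m : ℕ} (h : m ≤ n) :
    ((List.finRange n).filter fun b => b.val < m).length = m := by
  have h1 : ((List.finRange n).filter fun b => b.val < m).length =
      (Finset.univ.filter fun b : Fin n => b.val < m).card := by
    rw [← List.toFinset_card_of_nodup ((List.nodup_finRange n).filter _)]
    congr 1
    ext b
    simp
  rw [h1, Fin.card_filter_val_lt, min_eq_right h]

theorem countP_readRows {α : Type} {n : ℕ} (μ : YoungDiagram) (h : μ.card ≤ n)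
    (f : Fin n → α) (p : α → Bool) (a : Fin n) (hp : ∀ b, b ≠ a → p (f b) = false) :
    (readRows μ fun i _ => f i).countP p = if p (f a) then μ.rowLen a else 0 := by
  rw [readRows, List.countP_flatMap, ← List.ofFn_id, List.map_ofFn, List.sum_ofFn,
    Finset.sum_eq_single a]
  · rw [Function.comp_apply, Function.comp_apply, List.ofFn_id, List.countP_map]
    simp only [id]
    split_ifs with hpa
    · refine Eq.trans ?_ (length_filter_finRange ((rowLen_le_card μ a).trans h))
      rw [List.countP_eq_length]
      intro b _
      simpa using hpa
    · rw [List.countP_eq_zero]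
      intro b _
      simpa using hpa
  · intro b _ hb
    rw [Function.comp_apply, Function.comp_apply, List.countP_map, List.countP_eq_zero]
    intro c _
    simp [hp b hb]
  · simp

theorem card_filter_eq_countP {α : Type} (l : List α) {n : ℕ} (h : n = l.length) (p : α → Bool) :
    (Finset.univ.filter fun i : Fin n => p (l.get (i.cast h)) = true).card = l.countP p := by
  subst h
  have h2 : l.countP p = (List.finRange l.length).countP fun i => p (l.get i) := by
    conv_lhs => rw [← List.ofFn_get l, List.ofFn_eq_map, List.countP_map]
    rfl
  rw [h2, List.countP_eq_length_filter,
    ← List.toFinset_card_of_nodup ((List.nodup_finRange _).filter _)]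
  congr 1
  ext i
  simp

theorem Bipartition.content_word {n : ℕ} (lam : Bipartition n) (z : Bool) (a : Fin n) :
    lam.word.content z a = (lam.shape z).rowLen a := by
  have h := card_filter_eq_countP lam.wordList lam.length_wordList.symm
    fun l => decide (l.1 = a ∧ decide (l.2 = 0) = z)
  have hc := lam.card_add
  have h2 : lam.wordList.countP (fun l => decide (l.1 = a ∧ decide (l.2 = 0) = z)) =
      (lam.shape z).rowLen a := by
    rw [Bipartition.wordList, List.countP_append,
      countP_readRows _ (by omega) (fun a => (a, 0)) _ a (fun b hb => by simp [hb]),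
      countP_readRows _ (by omega) (fun a => (a, 1)) _ a (fun b hb => by simp [hb])]
    cases z <;> simp [shape]
  rw [← h2, ← h, Biword.content]
  congr 1
  ext i
  simp only [Finset.mem_filter, Finset.mem_univ, true_and, decide_eq_true_iff]
  exact Iff.rfl

theorem content_eq_of_mem_orbit {n : ℕ} {lam : Bipartition n} (x : X lam) (z : Bool) (a : Fin n) :
    x.1.content z a = (lam.shape z).rowLen a := by
  obtain ⟨σ, hσ⟩ := x.2
  rw [← hσ, ← lam.content_word]
  exact Biword.content_smul σ _ z a

theorem Bipartition.word_nonneg {n : ℕ} (lam : Bipartition n) (i : Fin n) :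
    0 ≤ lam.word.phase i := by
  change 0 ≤ (lam.word i).2
  have h : lam.word i ∈ lam.wordList := List.get_mem _ _
  simp only [wordList, readRows, List.mem_append, List.mem_flatMap, List.mem_map] at h
  obtain ⟨a, _, b, _, h⟩ | ⟨a, _, b, _, h⟩ := h <;> simp [← h]

theorem letter_eq_iff_of_nonneg {n : ℕ} {l m : Letter n} (hl : 0 ≤ l.2) (hm : 0 ≤ m.2) :
    l = m ↔ l.1 = m.1 ∧ decide (l.2 = 0) = decide (m.2 = 0) := by
  obtain ⟨a, s⟩ := l
  obtain ⟨b, t⟩ := m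
  simp only [Prod.mk.injEq] at *
  refine and_congr_right fun _ => ?_
  cases s <;> cases t <;> simp_all

/-- A biword with nonnegative phases and with the content of the canonical biword is one of its
rearrangements. -/
theorem mem_orbit_of_content {n : ℕ} {lam : Bipartition n} {w : Biword n}
    (h0 : ∀ i, 0 ≤ w.phase i) (h : ∀ z a, w.content z a = (lam.shape z).rowLen a) :
    w ∈ MulAction.orbit (H n) lam.word := by
  have key (v : Biword n) (hv : ∀ i, 0 ≤ v.phase i) (l : Letter n) :
      Fintype.card {i // v.letter i = l} =
        if 0 ≤ l.2 then v.content (decide (l.2 = 0)) l.1 else 0 := by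
    rw [Fintype.card_subtype]
    split_ifs with hl
    · rw [Biword.content]
      congr 1
      ext i
      simp only [Finset.mem_filter, Finset.mem_univ, true_and]
      exact letter_eq_iff_of_nonneg (hv i) hl
    · rw [Finset.card_eq_zero, Finset.filter_eq_empty_iff]
      intro i _ hi
      exact hl (hi ▸ hv i)
  have hcard (l : Letter n) :
      Fintype.card {i // lam.word.letter i = l} = Fintype.card {i // w.letter i = l} := by
    rw [key lam.word lam.word_nonneg, key w h0]
    simp only [lam.content_word, h]
  let π : Equiv.Perm (Fin n) := Equiv.ofFiberEquiv fun l => Fintype.equivOfCardEq (hcard l)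
  refine ⟨signedPerm π 1, Biword.smul_eq_of_ext fun i => ?_⟩
  rw [signedPerm_apply, Pi.one_apply, one_mul]
  have : w.letter (π i) = lam.word.letter i :=
    Equiv.ofFiberEquiv_map (fun l => Fintype.equivOfCardEq (hcard l)) i
  exact (w.ext_pos (π i)).trans this


/-! ### The free component is one orbit -/

/-- The columns of the pair `(x, y)` of biwords are, up to the bar involution, those that belong to
the cells of the Young bidiagram of `lam`. -/
structure Fills {n : ℕ} (lam : Bipartition n) (x y : Biword n) : Prop where
  unlike : Unlike x y
  mem_iff : ∀ (z : Bool) (a b : Fin n),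
    (∃ i, x.rad i = a ∧ y.rad i = b ∧ x.kind i = z) ↔ ((a : ℕ), (b : ℕ)) ∈ lam.shape z

theorem letter_pair_eq_or_bar_eq {n : ℕ} {l m l' m' : Letter n} (h1 : l.1 = l'.1)
    (h2 : m.1 = m'.1) (hk : decide (l.2 = 0) = decide (l'.2 = 0))
    (hu : decide (m.2 = 0) = !decide (l.2 = 0)) (hu' : decide (m'.2 = 0) = !decide (l'.2 = 0)) :
    (l' = l ∧ m' = m) ∨ (l'.bar = l ∧ m'.bar = m) := by
  obtain ⟨a, s⟩ := l
  obtain ⟨b, t⟩ := m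
  obtain ⟨a', s'⟩ := l'
  obtain ⟨b', t'⟩ := m'
  obtain rfl : a = a' := h1
  obtain rfl : b = b' := h2
  have key : ∀ s t s' t' : SignType, decide (s = 0) = decide (s' = 0) →
      decide (t = 0) = !decide (s = 0) → decide (t' = 0) = !decide (s' = 0) →
      (s' = s ∧ t' = t) ∨ (-s' = s ∧ -t' = t) := by decide
  simpa [Letter.bar] using key s t s' t' hk hu hu'

theorem columns_eq_of_rad_eq {n : ℕ} {x y x' y' : Biword n} (h : Unlike x y) (h' : Unlike x' y')
    {i j : Fin n} (hx : x.rad i = x'.rad j) (hy : y.rad i = y'.rad j)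
    (hk : x.kind i = x'.kind j) : ∃ ε, columns x' y' (j, ε) = columns x y (i, 1) := by
  rcases letter_pair_eq_or_bar_eq hx hy hk (h.kind_right i) (h'.kind_right j) with e | e
  · exact ⟨1, by rw [columns, columns]; simp only [Biword.ext_pos]; exact Prod.ext e.1 e.2⟩
  · exact ⟨-1, by
      rw [columns, columns]; simp only [Biword.ext_pos, Biword.ext_neg]; exact Prod.ext e.1 e.2⟩

theorem Fills.exists_columns_eq {n : ℕ} {lam : Bipartition n} {x y x' y' : Biword n}
    (h : Fills lam x y) (h' : Fills lam x' y') (p : SignedPoint n) :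
    ∃ q, columns x' y' q = columns x y p := by
  obtain ⟨i, ε⟩ := p
  obtain ⟨j, hj1, hj2, hj3⟩ := (h'.mem_iff _ _ _).2 ((h.mem_iff _ _ _).1 ⟨i, rfl, rfl, rfl⟩)
  obtain ⟨η, hη⟩ := columns_eq_of_rad_eq h.unlike h'.unlike hj1.symm hj2.symm hj3.symm
  rcases Int.units_eq_one_or ε with rfl | rfl
  · exact ⟨_, hη⟩
  · exact ⟨_, columns_bar_eq_iff.2 hη⟩

/-- Two pairs of biwords that fill the same bidiagram differ by a signed permutation, which matches
equal columns. -/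
theorem Fills.exists_smul_eq {n : ℕ} {lam : Bipartition n} {x y x' y' : Biword n}
    (h : Fills lam x y) (h' : Fills lam x' y') (hinj : Function.Injective (columns x' y')) :
    ∃ σ : H n, σ • x = x' ∧ σ • y = y' := by
  choose f hf using h.exists_columns_eq h'
  have hsurj : Function.Surjective f := fun q => by
    obtain ⟨p, hp⟩ := h'.exists_columns_eq h q
    exact ⟨p, hinj ((hf p).trans hp)⟩
  refine ⟨⟨Equiv.ofBijective f (Finite.injective_iff_bijective.1
    (Finite.injective_iff_surjective.2 hsurj)), fun p => hinj ?_⟩,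
    Biword.smul_eq_of_ext fun i => ?_, Biword.smul_eq_of_ext fun i => ?_⟩
  · exact (hf p.bar).trans (columns_bar_eq_iff.2 (hf p)).symm
  · exact (congrArg Prod.fst (hf (i, 1))).trans (x.ext_pos i)
  · exact (congrArg Prod.snd (hf (i, 1))).trans (y.ext_pos i)

/-- The columns of a free pair of rearrangements of the canonical biwords belong to the cells of the
bidiagram: they form, in each of the two components, a set of cells with the row lengths and column
lengths of the diagram. -/
theorem Free.fills {n : ℕ} {lam : Bipartition n} {x : X lam} {y : X lam.transpose}
    (h : Free x.1 y.1) : Fills lam x.1 y.1 := by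
  rw [free_iff] at h
  refine ⟨h.1, fun z a b => ?_⟩
  set I : Finset (Fin n) := Finset.univ.filter fun i => x.1.kind i = z with hI
  set g : Fin n → ℕ × ℕ := fun i => ((x.1.rad i : ℕ), (y.1.rad i : ℕ)) with hg
  have hginj : Set.InjOn g I := by
    intro i hi j hj hij
    simp only [hI, Finset.coe_filter, Finset.mem_univ, true_and, Set.mem_ofPred_eq] at hi hj
    simp only [hg, Prod.mk.injEq, Fin.val_inj] at hij
    obtain ⟨ε, hε⟩ := columns_eq_of_rad_eq h.1 h.1 hij.1 hij.2 (hi.trans hj.symm)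
    exact (congrArg Prod.fst (h.2 hε)).symm
  set A := I.image g with hA
  have hlt (c : ℕ × ℕ) (hc : c ∈ A) : c.1 < n ∧ c.2 < n := by
    obtain ⟨i, _, rfl⟩ := Finset.mem_image.1 hc
    exact ⟨(x.1.rad i).2, (y.1.rad i).2⟩
  have hcard (p : ℕ × ℕ → Prop) [DecidablePred p] :
      (A.filter p).card = (I.filter fun i => p (g i)).card := by
    rw [hA, Finset.filter_image, Finset.card_image_of_injOn]
    exact hginj.mono fun i hi => (Finset.mem_filter.1 hi).1
  have hrow (a : ℕ) : (A.filter fun c => c.1 = a).card = (lam.shape z).rowLen a := by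
    by_cases ha : a < n
    · rw [hcard, ← content_eq_of_mem_orbit x z ⟨a, ha⟩, Biword.content, hI, Finset.filter_filter]
      congr 1
      ext i
      simp [hg, Fin.ext_iff, and_comm]
    · rw [Finset.filter_eq_empty_iff.2 fun (c : ℕ × ℕ) hc e => ha ((e : c.1 = a) ▸ (hlt c hc).1),
        Finset.card_empty]
      by_contra hne
      exact ha (lam.lt_of_mem_shape
        (YoungDiagram.mem_iff_lt_rowLen.2 (Nat.pos_of_ne_zero (Ne.symm hne)))).1
  have hcol (b : ℕ) : (A.filter fun c => c.2 = b).card = (lam.shape z).colLen b := by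
    by_cases hb : b < n
    · have := content_eq_of_mem_orbit y (!z) ⟨b, hb⟩
      rw [Bipartition.shape_transpose, Bool.not_not, YoungDiagram.rowLen_transpose] at this
      rw [hcard, ← this, Biword.content, hI, Finset.filter_filter]
      congr 1
      ext i
      simp [hg, Fin.ext_iff, and_comm, h.1.kind_right]
    · rw [Finset.filter_eq_empty_iff.2 fun (c : ℕ × ℕ) hc e => hb ((e : c.2 = b) ▸ (hlt c hc).2),
        Finset.card_empty]
      by_contra hne
      exact hb (lam.lt_of_mem_shape
        (YoungDiagram.mem_iff_lt_colLen.2 (Nat.pos_of_ne_zero (Ne.symm hne)))).2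
  have hsub (c : ℕ × ℕ) (hc : c ∈ A) : c ∈ lam.shape z :=
    mem_youngDiagram_of_card_eq _ A hrow hcol hc
  constructor
  · rintro ⟨i, rfl, rfl, hz⟩
    exact hsub (g i) (Finset.mem_image_of_mem _ (by simpa [hI] using hz))
  · intro hmem
    have heq : (A.filter fun c => c.1 = (a : ℕ)) = (lam.shape z).row a := by
      refine Finset.eq_of_subset_of_card_le (fun c hc => ?_) ?_
      · rw [Finset.mem_filter] at hc
        exact YoungDiagram.mem_row_iff.2 ⟨hsub c hc.1, hc.2⟩
      · rw [hrow, YoungDiagram.rowLen_eq_card]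
    have hc : ((a : ℕ), (b : ℕ)) ∈ A.filter fun c => c.1 = (a : ℕ) := by
      rw [heq]
      exact YoungDiagram.mk_mem_row_iff.2 hmem
    obtain ⟨i, hi, he⟩ := Finset.mem_image.1 (Finset.mem_filter.1 hc).1
    simp only [hg, Prod.mk.injEq, Fin.val_inj] at he
    exact ⟨i, he.1, he.2, by simpa [hI] using hi⟩

/-- The first biword of the pair whose columns are those of the cells in reading order. -/
def Bipartition.columnFst {n : ℕ} (lam : Bipartition n) : Biword n := fun k => (lam.column k).1

/-- The second biword of the pair whose columns are those of the cells in reading order. -/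
def Bipartition.columnSnd {n : ℕ} (lam : Bipartition n) : Biword n := fun k => (lam.column k).2

theorem Bipartition.columns_columnFst_columnSnd {n : ℕ} (lam : Bipartition n) (k : Fin n) :
    columns lam.columnFst lam.columnSnd (k, 1) = lam.column k := by
  rw [columns, Biword.ext_pos, Biword.ext_pos]
  rfl

theorem mem_readRows {α : Type} {n : ℕ} {μ : YoungDiagram} {f : Fin n → Fin n → α} {c : α} :
    c ∈ readRows μ f ↔ ∃ a b : Fin n, ((a : ℕ), (b : ℕ)) ∈ μ ∧ f a b = c := by
  simp [readRows, YoungDiagram.mem_iff_lt_rowLen]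

theorem Bipartition.exists_column_iff {n : ℕ} (lam : Bipartition n) (c : Letter n × Letter n) :
    (∃ k, lam.column k = c) ↔
      (∃ a b : Fin n, ((a : ℕ), (b : ℕ)) ∈ lam.zero ∧ ((a, 0), (b, 1)) = c) ∨
      (∃ a b : Fin n, ((a : ℕ), (b : ℕ)) ∈ lam.one ∧ ((a, 1), (b, 0)) = c) := by
  rw [← mem_readRows (f := fun a b => (((a, 0), (b, 1)) : Letter n × Letter n)),
    ← mem_readRows (f := fun a b => (((a, 1), (b, 0)) : Letter n × Letter n)),
    ← List.mem_append, List.mem_iff_get]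
  constructor
  · rintro ⟨k, hk⟩
    exact ⟨k.cast lam.length_columnList.symm, hk⟩
  · rintro ⟨k, hk⟩
    exact ⟨k.cast lam.length_columnList, hk⟩

theorem Bipartition.fills_column {n : ℕ} (lam : Bipartition n) :
    Fills lam lam.columnFst lam.columnSnd := by
  refine ⟨unlike_of_kind fun k => ?_, fun z a b => ⟨?_, fun h => ?_⟩⟩
  · change decide ((lam.column k).2.2 = 0) = !decide ((lam.column k).1.2 = 0)
    rcases (lam.exists_column_iff _).1 ⟨k, rfl⟩ with ⟨a, b, _, h⟩ | ⟨a, b, _, h⟩ <;>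
      simp [← h]
  · rintro ⟨k, h1, h2, h3⟩
    change (lam.column k).1.1 = a at h1
    change (lam.column k).2.1 = b at h2
    change decide ((lam.column k).1.2 = 0) = z at h3
    rcases (lam.exists_column_iff _).1 ⟨k, rfl⟩ with ⟨a', b', h4, h⟩ | ⟨a', b', h4, h⟩ <;>
    · simp only [← h] at h1 h2 h3
      subst h1 h2
      simp at h3
      subst h3
      exact h4
  · cases z
    · obtain ⟨k, hk⟩ := (lam.exists_column_iff ((a, 1), (b, 0))).2 (.inr ⟨a, b, h, rfl⟩)
      refine ⟨k, ?_, ?_, ?_⟩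
      · exact congrArg (fun c => c.1.1) hk
      · exact congrArg (fun c => c.2.1) hk
      · change decide ((lam.column k).1.2 = 0) = false
        simp [hk]
    · obtain ⟨k, hk⟩ := (lam.exists_column_iff ((a, 0), (b, 1))).2 (.inl ⟨a, b, h, rfl⟩)
      refine ⟨k, ?_, ?_, ?_⟩
      · exact congrArg (fun c => c.1.1) hk
      · exact congrArg (fun c => c.2.1) hk
      · change decide ((lam.column k).1.2 = 0) = true
        simp [hk]

/-- The reading word of a free pair is the signed permutation that moves the reading-order pair to
it. -/
theorem Free.exists_flat_eq {n : ℕ} {lam : Bipartition n} {x : X lam} {y : X lam.transpose}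
    (h : Free x.1 y.1) : ∃ σ : H n, ∀ k, flat lam x.1 y.1 k = σ.1 (k, 1) ∧
      columns x.1 y.1 (σ.1 (k, 1)) = lam.column k := by
  obtain ⟨σ, hx, hy⟩ := lam.fills_column.exists_smul_eq h.fills (free_iff.1 h).2
  refine ⟨σ, fun k => ?_⟩
  have hc : columns x.1 y.1 (σ.1 (k, 1)) = lam.column k := by
    rw [← hx, ← hy, columns_smul, lam.columns_columnFst_columnSnd]
  refine ⟨?_, hc⟩
  have : Nonempty (SignedPoint n) := ⟨(k, 1)⟩
  rw [flat, ← hc]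
  exact Function.leftInverse_invFun (free_iff.1 h).2 _

theorem Free.columns_flat {n : ℕ} {lam : Bipartition n} {x : X lam} {y : X lam.transpose}
    (h : Free x.1 y.1) (k : Fin n) : columns x.1 y.1 (flat lam x.1 y.1 k) = lam.column k := by
  obtain ⟨σ, hσ⟩ := h.exists_flat_eq
  rw [(hσ k).1, (hσ k).2]

theorem Free.sgnFun_flat_ne_zero {n : ℕ} {lam : Bipartition n} {x : X lam} {y : X lam.transpose}
    (h : Free x.1 y.1) : sgnFun (flat lam x.1 y.1) ≠ 0 := by
  obtain ⟨σ, hσ⟩ := h.exists_flat_eq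
  rw [funext fun k => (hσ k).1]
  exact sgn_ne_zero σ

theorem Free.flat_smul {n : ℕ} {lam : Bipartition n} {x : X lam} {y : X lam.transpose}
    (h : Free x.1 y.1) (σ : H n) (k : Fin n) :
    flat lam (σ • x).1 (σ • y).1 k = σ.1 (flat lam x.1 y.1 k) := by
  have h' : Free (σ • x).1 (σ • y).1 := h.smul σ
  apply (free_iff.1 h').2
  rw [h'.columns_flat, MulAction.orbit.coe_smul, MulAction.orbit.coe_smul, columns_smul,
    h.columns_flat]

/-! ### The Specht matrix and the Specht vectors -/

theorem spechtMatrix_of_free {n : ℕ} {lam : Bipartition n} {x : X lam} {y : X lam.transpose}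
    (h : Free x.1 y.1) : spechtMatrix lam y x = sgnFun (flat lam x.1 y.1) := by
  simp [spechtMatrix, h]

theorem spechtMatrix_ne_zero_iff {n : ℕ} {lam : Bipartition n} {x : X lam}
    {y : X lam.transpose} : spechtMatrix lam y x ≠ 0 ↔ Free x.1 y.1 := by
  by_cases h : Free x.1 y.1
  · simp [spechtMatrix_of_free h, h, h.sgnFun_flat_ne_zero]
  · simp [spechtMatrix, h]

/-- The Specht matrix is equivariant up to the sign character. -/
theorem spechtMatrix_smul {n : ℕ} {lam : Bipartition n} (σ : H n) (y : X lam.transpose)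
    (x : X lam) :
    spechtMatrix lam (σ • y) (σ • x) = sgn σ * spechtMatrix lam y x := by
  by_cases h : Free x.1 y.1
  · have h' : Free (σ • x).1 (σ • y).1 := h.smul σ
    rw [spechtMatrix_of_free h, spechtMatrix_of_free h', funext (h.flat_smul σ), sgnFun_comp]
    push_cast
    rfl
  · have h' : ¬ Free (σ • x).1 (σ • y).1 := fun h' => h ((free_smul_iff σ).1 h')
    rw [← spechtMatrix_ne_zero_iff, not_not] at h h'
    rw [h, h', mul_zero]

/-- The Specht vector of a bitableau `(x, y)` is the row `y` of the Specht matrix: both are supported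
on the words `x'` for which `(x', y)` is free, and each of these is the image of `x` under a unique
element of the stabilizer of `y`. -/
theorem spechtVector_apply {n : ℕ} {lam : Bipartition n} {x : X lam} {y : X lam.transpose}
    (h : Free x.1 y.1) (x' : X lam) : spechtVector lam x y x' = spechtMatrix lam y x' := by
  classical
  have hsum : spechtVector lam x y x' = (sgnFun (flat lam x.1 y.1) : ℂ) *
      ∑ σ : H n with σ • y.1 = y.1, (sgn σ : ℂ) * if σ • x = x' then 1 else 0 := by
    rw [spechtVector, colSum, map_sum]
    simp [LinearMap.sum_apply, Representation.asAlgebraHom_single, rho,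
      Finsupp.single_apply]
  rw [hsum, ← spechtMatrix_of_free h]
  by_cases h' : Free x'.1 y.1
  · obtain ⟨σ, hx, hy⟩ := h.fills.exists_smul_eq h'.fills (free_iff.1 h').2
    have hx' : σ • x = x' := Subtype.ext hx
    have hy' : σ • y = y := Subtype.ext hy
    rw [Finset.sum_eq_single σ]
    · rw [if_pos hx', mul_one]
      conv_rhs => rw [← hx', ← hy', spechtMatrix_smul]
      rw [mul_comm]
    · intro τ hτ hne
      rw [if_neg, mul_zero]
      intro hτx
      apply hne
      have : σ⁻¹ * τ ∈ MulAction.stabilizer (H n) ((x.1, y.1) : Biword n × Biword n) := by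
        rw [MulAction.mem_stabilizer_iff, mul_smul, inv_smul_eq_iff, Prod.smul_mk, Prod.smul_mk,
          hx, hy, (Finset.mem_filter.1 hτ).2]
        exact congrArg (fun w : X lam => (w.1, y.1)) hτx
      rw [h.2, Subgroup.mem_bot, inv_mul_eq_one] at this
      exact this.symm
    · intro hσ
      exact absurd (Finset.mem_filter.2 ⟨Finset.mem_univ σ, hy⟩) hσ
  · rw [Finset.sum_eq_zero, mul_zero]
    · rw [← spechtMatrix_ne_zero_iff, not_not] at h'
      exact h'.symm
    · intro σ hσ
      rw [if_neg, mul_zero]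
      rintro rfl
      apply h'
      have := h.smul σ
      rwa [(Finset.mem_filter.1 hσ).2] at this


/-! ### Normalising the phases -/

/-- The biword with the same radii and the absolute values of the phases. -/
def Biword.abs {n : ℕ} (w : Biword n) : Biword n :=
  fun i => (w.rad i, if w.phase i = 0 then 0 else 1)

theorem Biword.kind_abs {n : ℕ} (w : Biword n) (i : Fin n) : w.abs.kind i = w.kind i := by
  change decide ((if w.phase i = 0 then (0 : SignType) else 1) = 0) = decide (w.phase i = 0)
  split_ifs with h <;> simp [h]

theorem Biword.abs_nonneg {n : ℕ} (w : Biword n) (i : Fin n) : 0 ≤ w.abs.phase i := by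
  change 0 ≤ (if w.phase i = 0 then (0 : SignType) else 1)
  split_ifs <;> simp

/-- The sign change at the positions at which a biword has a negative phase. -/
def Biword.signChange {n : ℕ} (w : Biword n) : H n :=
  signedPerm 1 fun i => if w.phase i = -1 then -1 else 1

theorem Biword.signChange_smul {n : ℕ} (w : Biword n) : w.signChange • w = w.abs := by
  refine Biword.smul_eq_of_ext fun i => ?_
  have key (l : Letter n) :
      ((l.1, if l.2 = 0 then (0 : SignType) else 1) : Letter n) = if l.2 = -1 then l.bar else l := by
    obtain ⟨a, s⟩ := l
    cases s <;> simp [Letter.bar]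
  have h := key (w.letter i)
  rw [Biword.signChange, signedPerm_apply]
  by_cases hi : w.phase i = -1
  · have h' : w.abs i = (w.letter i).bar := h.trans (if_pos hi)
    simp only [hi, if_true, mul_one, Equiv.Perm.one_apply, Biword.ext_neg, h', Letter.bar_bar]
    rfl
  · have h' : w.abs i = w.letter i := h.trans (if_neg hi)
    simp only [hi, if_false, mul_one, Equiv.Perm.one_apply, Biword.ext_pos, h']
    rfl

theorem Unlike.signChange_smul {n : ℕ} {w v : Biword n} (h : Unlike w v) :
    w.signChange • v = v := by
  refine Biword.smul_eq_of_ext fun i => ?_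
  rw [Biword.signChange, signedPerm_apply]
  by_cases hi : w.phase i = -1
  · have h0 : v.phase i = 0 := by
      by_contra h0
      have : w.phase i = 0 := (h.left_eq_zero_iff i).2 h0
      rw [hi] at this
      exact absurd this (by decide)
    simp only [hi, if_true, mul_one, Equiv.Perm.one_apply, Biword.ext_neg]
    refine Prod.ext rfl ?_
    change -v.phase i = v.phase i
    rw [h0, neg_zero]
  · simp only [hi, if_false, mul_one, Equiv.Perm.one_apply, Biword.ext_pos]

theorem unlike_abs_iff {n : ℕ} {w v : Biword n} : Unlike w.abs v ↔ Unlike w v := by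
  constructor
  · intro h
    exact unlike_of_kind fun i => by rw [h.kind_right, w.kind_abs]
  · intro h
    exact unlike_of_kind fun i => by rw [h.kind_right, w.kind_abs]

theorem spechtMatrix_of_not_unlike {n : ℕ} {lam : Bipartition n} {x : X lam}
    {y : X lam.transpose} (h : ¬ Unlike x.1 y.1) : spechtMatrix lam y x = 0 := by
  by_contra h0
  exact h (spechtMatrix_ne_zero_iff.1 h0).1

theorem spechtMatrix_signChange_right {n : ℕ} {lam : Bipartition n} (y : X lam.transpose)
    (x : X lam) :
    spechtMatrix lam y (x.1.signChange • x) = sgn x.1.signChange * spechtMatrix lam y x := by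
  by_cases h : Unlike x.1 y.1
  · have hy : x.1.signChange • y = y := Subtype.ext h.signChange_smul
    conv_lhs => rw [← hy, spechtMatrix_smul]
  · rw [spechtMatrix_of_not_unlike h, spechtMatrix_of_not_unlike, mul_zero]
    rwa [MulAction.orbit.coe_smul, x.1.signChange_smul, unlike_abs_iff]

theorem spechtMatrix_signChange_left {n : ℕ} {lam : Bipartition n} (y : X lam.transpose)
    (x : X lam) :
    spechtMatrix lam (y.1.signChange • y) x = sgn y.1.signChange * spechtMatrix lam y x := by
  by_cases h : Unlike x.1 y.1
  · have hx : y.1.signChange • x = x := Subtype.ext h.swap.signChange_smul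
    conv_lhs => rw [← hx, spechtMatrix_smul]
  · rw [spechtMatrix_of_not_unlike h, spechtMatrix_of_not_unlike, mul_zero]
    rw [MulAction.orbit.coe_smul, y.1.signChange_smul]
    exact fun h' => h (unlike_abs_iff.1 h'.swap).swap

/-! ### Standard pairs -/

theorem Biword.letter_eq_iff {n : ℕ} {x y : Biword n} {i j : Fin n} (hx : 0 ≤ x.phase i)
    (hy : 0 ≤ y.phase j) :
    x.letter i = y.letter j ↔ x.rad i = y.rad j ∧ x.kind i = y.kind j :=
  letter_eq_iff_of_nonneg hx hy

theorem Biword.eq_of_rad_eq {n : ℕ} {x y : Biword n} (hx : ∀ i, 0 ≤ x.phase i)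
    (hy : ∀ i, 0 ≤ y.phase i) (hr : x.rad = y.rad) (hk : ∀ i, x.kind i = y.kind i) : x = y :=
  funext fun i => (Biword.letter_eq_iff (hx i) (hy i)).2 ⟨congrFun hr i, hk i⟩

theorem Biword.ext_fst {n : ℕ} (w : Biword n) (p : SignedPoint n) : (w.ext p).1 = w.rad p.1 := by
  rw [Biword.ext]
  split_ifs <;> rfl

theorem Biword.ext_kind {n : ℕ} (w : Biword n) (p : SignedPoint n) :
    decide ((w.ext p).2 = 0) = w.kind p.1 := by
  rw [Biword.ext]
  split_ifs
  · rfl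
  · simp only [Letter.bar, SignType.neg_eq_zero_iff]
    rfl

theorem IsStandard.swap {n : ℕ} {x y : Biword n} (h : IsStandard x y) : IsStandard y x where
  unlike := h.unlike.swap
  left_nonneg := h.right_nonneg
  right_nonneg := h.left_nonneg
  right_increasing := h.left_increasing
  left_increasing := h.right_increasing

theorem IsStandard.free {n : ℕ} {x y : Biword n} (h : IsStandard x y) : Free x y := by
  refine free_iff.2 ⟨h.unlike, fun p q hpq => ?_⟩
  have key (w : Biword n) (hw : ∀ i, 0 ≤ w.phase i) (e : w.ext p = w.ext q) :
      w.letter p.1 = w.letter q.1 :=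
    (Biword.letter_eq_iff (hw _) (hw _)).2
      ⟨by rw [← Biword.ext_fst, e, Biword.ext_fst], by rw [← Biword.ext_kind, e, Biword.ext_kind]⟩
  have hx : x p.1 = x q.1 := key x h.left_nonneg (congrArg Prod.fst hpq)
  have hy : y p.1 = y q.1 := key y h.right_nonneg (congrArg Prod.snd hpq)
  have h1 : p.1 = q.1 := by
    rcases lt_trichotomy p.1 q.1 with hlt | heq | hlt
    · have := h.right_increasing _ _ hlt hx
      rw [hy] at this
      exact absurd this (lt_irrefl _)
    · exact heq
    · have := h.right_increasing _ _ hlt hx.symm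
      rw [hy] at this
      exact absurd this (lt_irrefl _)
  obtain ⟨i, ε⟩ := p
  obtain ⟨j, η⟩ := q
  obtain rfl : i = j := h1
  by_contra hne
  have hε : η = -ε := by
    rcases Int.units_eq_one_or ε with rfl | rfl <;>
      rcases Int.units_eq_one_or η with rfl | rfl <;> simp_all
  subst hε
  exact h.unlike.columns_bar_ne (i, ε) hpq.symm

/-- Among the words `x'` with nonnegative phases for which `(x', y)` is free, the one that makes the
pair standard is lexicographically smallest with respect to the radii: at the first difference it
uses the smallest radius that is left. -/
theorem IsStandard.toLex_rad_le {n : ℕ} {x y x' : Biword n} (h : IsStandard x y)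
    (hex : ∀ k, ∃ j, x.rad j = x'.rad k ∧ y.rad j = y.rad k ∧ y.kind j = y.kind k)
    (hfree : Free x' y) : toLex x.rad ≤ toLex x'.rad := by
  by_contra hlt
  rw [not_le] at hlt
  obtain ⟨k, hk, hklt⟩ := hlt
  change x'.rad k < x.rad k at hklt
  obtain ⟨j, hjx, hjy, hjk⟩ := hex k
  have hletter : y j = y k :=
    (Biword.letter_eq_iff (h.right_nonneg j) (h.right_nonneg k)).2 ⟨hjy, hjk⟩
  have hlt : j < k := by
    rcases lt_trichotomy j k with hlt | rfl | hlt
    · exact hlt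
    · rw [hjx] at hklt
      exact absurd hklt (lt_irrefl _)
    · have : x.rad k < x.rad j := h.left_increasing _ _ hlt hletter.symm
      rw [hjx] at this
      exact absurd this hklt.asymm
  have h1 : x'.rad j = x'.rad k := (hk j hlt).trans hjx
  obtain ⟨ε, hε⟩ := columns_eq_of_rad_eq hfree.1 hfree.1 h1 hjy
    (by rw [hfree.1.swap.kind_right, hfree.1.swap.kind_right, hjk])
  exact hlt.ne (congrArg Prod.fst ((free_iff.1 hfree).2 hε)).symm

theorem SYT.free {n : ℕ} {lam : Bipartition n} (T : SYT lam) : Free T.x.1 T.y.1 := T.2.free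

theorem SYT.toLex_rad_le {n : ℕ} {lam : Bipartition n} (T : SYT lam) {x : X lam}
    (h : Free x.1 T.y.1) : toLex T.x.1.rad ≤ toLex x.1.rad := by
  refine T.2.toLex_rad_le (fun k => ?_) h
  obtain ⟨j, h1, h2, h3⟩ :=
    (T.free.fills.mem_iff _ _ _).2 ((h.fills.mem_iff _ _ _).1 ⟨k, rfl, rfl, rfl⟩)
  refine ⟨j, h1, h2, ?_⟩
  change T.y.1.kind j = T.y.1.kind k
  rw [T.free.1.kind_right, h.1.kind_right, h3]

theorem SYT.toLex_rad_le' {n : ℕ} {lam : Bipartition n} (T : SYT lam) {y : X lam.transpose}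
    (h : Free T.x.1 y.1) : toLex T.y.1.rad ≤ toLex y.1.rad := by
  refine T.2.swap.toLex_rad_le (fun k => ?_) ?_
  · obtain ⟨j, h1, h2, h3⟩ :=
      (T.free.fills.mem_iff _ _ _).2 ((h.fills.mem_iff _ _ _).1 ⟨k, rfl, rfl, rfl⟩)
    exact ⟨j, h2, h1, h3⟩
  · exact free_iff.2 ⟨h.1.swap, fun p q hpq =>
      (free_iff.1 h).2 (Prod.ext (congrArg Prod.snd hpq) (congrArg Prod.fst hpq))⟩

theorem SYT.ext_of_y {n : ℕ} {lam : Bipartition n} {T T' : SYT lam} (hy : T.y = T'.y)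
    (hx : toLex T.x.1.rad = toLex T'.x.1.rad) : T = T' := by
  refine Subtype.ext (Prod.ext (Subtype.ext ?_) hy)
  refine Biword.eq_of_rad_eq T.2.left_nonneg T'.2.left_nonneg hx fun i => ?_
  rw [T.2.unlike.swap.kind_right, T'.2.unlike.swap.kind_right]
  exact congrArg (fun y : X lam.transpose => !y.1.kind i) hy

theorem SYT.ext_of_x {n : ℕ} {lam : Bipartition n} {T T' : SYT lam} (hx : T.x = T'.x)
    (hy : toLex T.y.1.rad = toLex T'.y.1.rad) : T = T' := by
  refine Subtype.ext (Prod.ext hx (Subtype.ext ?_))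
  refine Biword.eq_of_rad_eq T.2.right_nonneg T'.2.right_nonneg hy fun i => ?_
  rw [T.2.unlike.kind_right, T'.2.unlike.kind_right]
  exact congrArg (fun x : X lam => !x.1.kind i) hx

theorem SYT.y_injective {n : ℕ} {lam : Bipartition n} :
    Function.Injective (SYT.y (lam := lam)) := fun T T' h =>
  SYT.ext_of_y h (le_antisymm (T.toLex_rad_le (h ▸ T'.free)) (T'.toLex_rad_le (h ▸ T.free)))

theorem SYT.x_injective {n : ℕ} {lam : Bipartition n} :
    Function.Injective (SYT.x (lam := lam)) := fun T T' h =>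
  SYT.ext_of_x h (le_antisymm (T.toLex_rad_le' (h ▸ T'.free)) (T'.toLex_rad_le' (h ▸ T.free)))

/-- The Specht matrix is triangular with nonzero diagonal on the standard pairs, ordered by the radii
of their first words. -/
theorem isUnit_heart_spechtMatrix {n : ℕ} (lam : Bipartition n) :
    IsUnit (heart (spechtMatrix lam)) := by
  rw [← Matrix.vecMul_injective_iff_isUnit]
  refine (injective_iff_map_eq_zero (Matrix.vecMulLinear (heart (spechtMatrix lam)))).2
    fun c hc => ?_
  by_contra hne
  obtain ⟨T₀, hT₀⟩ := Function.ne_iff.1 hne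
  -- a standard pair in the support of `c` with minimal first word
  obtain ⟨T, hT, hmin⟩ := Finset.exists_min_image (Finset.univ.filter fun T => c T ≠ 0)
    (fun T => toLex T.x.1.rad) ⟨T₀, by simpa using hT₀⟩
  have h := congrFun hc T
  rw [Matrix.vecMulLinear_apply, Matrix.vecMul, dotProduct, Finset.sum_eq_single T] at h
  · have hd : spechtMatrix lam T.y T.x ≠ 0 := spechtMatrix_ne_zero_iff.2 T.free
    exact mul_ne_zero (by simpa using hT) hd h
  · intro T' _ hne'
    by_contra h0
    have h1 := left_ne_zero_of_mul h0
    have hf : Free T.x.1 T'.y.1 := spechtMatrix_ne_zero_iff.1 (right_ne_zero_of_mul h0)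
    have hle := T'.toLex_rad_le hf
    have hle' := hmin T' (by simpa using h1)
    refine hne' (SYT.x_injective (Subtype.ext ?_))
    refine Biword.eq_of_rad_eq T'.2.left_nonneg T.2.left_nonneg
      (toLex.injective (le_antisymm hle hle')) fun i => ?_
    rw [T'.free.1.swap.kind_right]
    exact (hf.1.swap.kind_right i).symm
  · simp


/-! ### The standard partner of a word -/

/-- The number of earlier positions with the same value. -/
def rank {n : ℕ} {α : Type} [DecidableEq α] (f : Fin n → α) (i : Fin n) : ℕ :=
  (Finset.univ.filter fun j => j < i ∧ f j = f i).card

theorem rank_lt_rank {n : ℕ} {α : Type} [DecidableEq α] {f : Fin n → α} {i j : Fin n}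
    (hij : i < j) (h : f i = f j) : rank f i < rank f j := by
  refine Finset.card_lt_card (Finset.ssubset_iff_of_subset (fun k hk => ?_) |>.2 ⟨i, ?_, ?_⟩)
  · simp only [Finset.mem_filter, Finset.mem_univ, true_and] at hk ⊢
    exact ⟨hk.1.trans hij, hk.2.trans h⟩
  · simpa using ⟨hij, h⟩
  · simp

theorem eq_of_rank_eq {n : ℕ} {α : Type} [DecidableEq α] {f : Fin n → α} {i j : Fin n}
    (h : f i = f j) (hr : rank f i = rank f j) : i = j := by
  rcases lt_trichotomy i j with hlt | heq | hlt
  · exact absurd hr (rank_lt_rank hlt h).ne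
  · exact heq
  · exact absurd hr (rank_lt_rank hlt h.symm).ne'

theorem rank_lt_card {n : ℕ} {α : Type} [DecidableEq α] (f : Fin n → α) (i : Fin n) :
    rank f i < (Finset.univ.filter fun j => f j = f i).card := by
  refine Finset.card_lt_card (Finset.ssubset_iff_of_subset (fun k hk => ?_) |>.2 ⟨i, ?_, ?_⟩)
  · simp only [Finset.mem_filter, Finset.mem_univ, true_and] at hk ⊢
    exact hk.2
  · simp
  · simp

theorem exists_rank_eq {n : ℕ} {α : Type} [DecidableEq α] (f : Fin n → α) (l : α) {a : ℕ}
    (ha : a < (Finset.univ.filter fun j => f j = l).card) : ∃ i, f i = l ∧ rank f i = a := by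
  obtain ⟨i, hi, hr⟩ := Finset.surjOn_of_injOn_of_card_le
    (s := Finset.univ.filter fun j => f j = l)
    (t := Finset.range (Finset.univ.filter fun j => f j = l).card) (rank f)
    (fun i hi => by
      have hi' : f i = l := by simpa using hi
      have := rank_lt_card f i
      rw [hi'] at this
      simpa using this)
    (fun i hi j hj hr => by
      have hi' : f i = l := by simpa using hi
      have hj' : f j = l := by simpa using hj
      exact eq_of_rank_eq (hi'.trans hj'.symm) hr)
    (by simp) (by simpa using ha)
  exact ⟨i, by simpa using hi, hr⟩

theorem rank_lt {n : ℕ} {α : Type} [DecidableEq α] (f : Fin n → α) (i : Fin n) :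
    rank f i < n :=
  (rank_lt_card f i).trans_le (Finset.card_le_univ _ |>.trans_eq (Fintype.card_fin n))

/-- The only word which can form a standard pair with `y`: the positions of each letter of `y` are
numbered from left to right. -/
def Biword.partner {n : ℕ} (y : Biword n) : Biword n :=
  fun i => (⟨rank y.letter i, rank_lt _ _⟩, if y.kind i then 1 else 0)

theorem Biword.phase_partner {n : ℕ} (y : Biword n) (i : Fin n) :
    y.partner.phase i = if y.kind i then 1 else 0 := rfl

theorem Biword.kind_partner {n : ℕ} (y : Biword n) (i : Fin n) :
    y.partner.kind i = !y.kind i := by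
  rw [Biword.kind, Biword.phase_partner]
  cases y.kind i <;> simp

theorem Biword.partner_nonneg {n : ℕ} (y : Biword n) (i : Fin n) : 0 ≤ y.partner.phase i := by
  rw [Biword.phase_partner]
  split_ifs <;> simp

theorem card_letter_eq {n : ℕ} {lam : Bipartition n} (y : X lam) (hy : ∀ i, 0 ≤ y.1.phase i)
    (z : Bool) (b : Fin n) :
    (Finset.univ.filter fun j => y.1.letter j = (b, if z then 0 else 1)).card =
      (lam.shape z).rowLen b := by
  rw [← content_eq_of_mem_orbit y z b, Biword.content]
  congr 1
  ext i
  simp only [Finset.mem_filter, Finset.mem_univ, true_and]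
  refine (letter_eq_iff_of_nonneg (hy i) (by cases z <;> simp)).trans ?_
  have : decide ((if z = true then (0 : SignType) else 1) = 0) = z := by cases z <;> simp
  simp only [this]
  rfl

theorem partner_mem_orbit {n : ℕ} {lam : Bipartition n} (y : X lam.transpose)
    (hy : ∀ i, 0 ≤ y.1.phase i) : y.1.partner ∈ MulAction.orbit (H n) lam.word := by
  refine mem_orbit_of_content y.1.partner_nonneg fun z a => ?_
  set l : Fin n → Letter n := fun b => (b, if !z then 0 else 1) with hl
  have hletter (i : Fin n) : y.1.letter i = l (y.1.rad i) ↔ y.1.kind i = !z := by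
    refine (letter_eq_iff_of_nonneg (hy i) (by cases z <;> simp [hl])).trans ?_
    have : decide ((l (y.1.rad i)).2 = 0) = !z := by cases z <;> simp [hl]
    simp only [this]
    exact ⟨fun h => h.2, fun h => ⟨rfl, h⟩⟩
  have hcard (b : Fin n) : (Finset.univ.filter fun j => y.1.letter j = l b).card =
      (lam.shape z).colLen b := by
    rw [hl, card_letter_eq y hy, Bipartition.shape_transpose, Bool.not_not,
      YoungDiagram.rowLen_transpose]
  rw [← min_eq_right ((rowLen_le_card (lam.shape z) a).trans (lam.card_shape_le z)),
    ← Fin.card_filter_val_lt, Biword.content]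
  refine Finset.card_nbij y.1.rad (fun i hi => ?_) (fun i hi j hj hij => ?_) (fun b hb => ?_)
  · simp only [Finset.coe_filter, Finset.mem_univ, true_and, Set.mem_ofPred_eq,
      y.1.kind_partner] at hi ⊢
    rw [← YoungDiagram.mem_iff_lt_rowLen, YoungDiagram.mem_iff_lt_colLen, ← hcard, ← hi.1,
      ← (hletter i).2 (by rw [← hi.2, Bool.not_not])]
    exact rank_lt_card _ i
  · simp only [Finset.coe_filter, Finset.mem_univ, true_and, Set.mem_ofPred_eq,
      y.1.kind_partner] at hi hj
    refine eq_of_rank_eq (f := y.1.letter) ?_ (congrArg Fin.val (hi.1.trans hj.1.symm))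
    rw [(hletter i).2 (by rw [← hi.2, Bool.not_not]), (hletter j).2 (by rw [← hj.2, Bool.not_not]),
      hij]
  · simp only [Finset.coe_filter, Finset.mem_univ, true_and, Set.mem_ofPred_eq] at hb
    rw [← YoungDiagram.mem_iff_lt_rowLen, YoungDiagram.mem_iff_lt_colLen, ← hcard] at hb
    obtain ⟨i, hi, hr⟩ := exists_rank_eq _ _ hb
    have hrad : y.1.rad i = b := congrArg Prod.fst hi
    refine ⟨i, ?_, hrad⟩
    simp only [Finset.coe_filter, Finset.mem_univ, true_and, Set.mem_ofPred_eq, y.1.kind_partner]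
    refine ⟨Fin.ext hr, ?_⟩
    rw [← hrad] at hi
    rw [(hletter i).1 hi, Bool.not_not]

/-- If `y` has no standard partner, then for some `a` the `a`-th occurrence `j` of a letter comes after
the `a`-th occurrence `i` of a letter of larger radius and the same phase. -/
theorem exists_standard_or_descent {n : ℕ} {lam : Bipartition n} (y : X lam.transpose)
    (hy : ∀ i, 0 ≤ y.1.phase i) :
    (∃ T : SYT lam, T.y = y) ∨ ∃ i j, i < j ∧ y.1.kind i = y.1.kind j ∧
      y.1.rad j < y.1.rad i ∧ rank y.1.letter i = rank y.1.letter j := by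
  by_cases h : ∃ i j, i < j ∧ y.1.kind i = y.1.kind j ∧
      y.1.rad j < y.1.rad i ∧ rank y.1.letter i = rank y.1.letter j
  · exact .inr h
  · refine .inl ⟨⟨(⟨_, partner_mem_orbit y hy⟩, y), ?_⟩, rfl⟩
    refine ⟨unlike_of_kind fun i => ?_, y.1.partner_nonneg, hy, fun i j hij hx => ?_,
      fun i j hij hl => ?_⟩
    · rw [y.1.kind_partner, Bool.not_not]
    · have hr : rank y.1.letter i = rank y.1.letter j := congrArg (fun l => (l.1 : ℕ)) hx
      have hk : y.1.kind i = y.1.kind j := by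
        have : y.1.partner.kind i = y.1.partner.kind j :=
          congrArg (fun l : Letter n => decide (l.2 = 0)) hx
        rwa [y.1.kind_partner, y.1.kind_partner, Bool.not_inj_iff] at this
      change y.1.rad i < y.1.rad j
      by_contra hlt
      rcases (not_lt.1 hlt).lt_or_eq with hlt | heq
      · exact h ⟨i, j, hij, hk, hlt, hr⟩
      · exact hij.ne (eq_of_rank_eq ((Biword.letter_eq_iff (hy i) (hy j)).2 ⟨heq.symm, hk⟩) hr)
    · exact rank_lt_rank (f := y.1.letter) hij hl

/-! ### Garnir relations and spanning -/

theorem Biword.letter_signedPerm_smul {n : ℕ} (π : Equiv.Perm (Fin n)) (w : Biword n)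
    (i : Fin n) : (signedPerm π 1 • w).letter (π i) = w.letter i := by
  have h := Biword.ext_smul_apply (signedPerm π 1) w (i, 1)
  rw [signedPerm_apply, Pi.one_apply, one_mul, Biword.ext_pos, Biword.ext_pos] at h
  exact h

/-- Garnir relation. Let `A` be larger than the column of the diagram that belongs to the letter `m`,
hence also than the one of `l`. The rows of the Specht matrix that belong to the words with letters
`l` and `m` on `A` and with the letters of `w` elsewhere add up to zero: if one of them is nonzero at
`x`, then `x` has equal letters at two points of `A`, and the exchange of these two points fixes `x`,
permutes the words and changes the signs. -/
theorem sum_spechtMatrix_eq_zero {n : ℕ} {lam : Bipartition n} (A : Finset (Fin n))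
    (R : Finset (X lam.transpose)) (w : Biword n) (l m : Letter n)
    (hR : ∀ y, y ∈ R ↔ (∀ k ∉ A, y.1.letter k = w.letter k) ∧
      ∀ k ∈ A, y.1.letter k = l ∨ y.1.letter k = m)
    (hkind : decide (m.2 = 0) = decide (l.2 = 0)) (hrad : m.1 ≤ l.1)
    (hcard : (lam.shape !decide (m.2 = 0)).colLen m.1 < A.card) (x : X lam)
    (hx : ∀ i, 0 ≤ x.1.phase i) : ∑ y ∈ R, spechtMatrix lam y x = 0 := by
  by_contra hne
  obtain ⟨y₀, hy₀, hne₀⟩ := Finset.exists_ne_zero_of_sum_ne_zero hne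
  have hf := spechtMatrix_ne_zero_iff.1 hne₀
  have hy₀' := ((hR y₀).1 hy₀).2
  have hkA (k : Fin n) (hk : k ∈ A) : x.1.kind k = !decide (m.2 = 0) := by
    rw [hf.1.swap.kind_right]
    congr 1
    rcases hy₀' k hk with h | h
    · rw [hkind, ← h]
      rfl
    · rw [← h]
      rfl
  have hmaps (k : Fin n) (hk : k ∈ A) :
      (x.1.rad k : ℕ) ∈ Finset.range ((lam.shape !decide (m.2 = 0)).colLen m.1) := by
    have hmem := (hf.fills.mem_iff _ _ _).1 ⟨k, rfl, rfl, hkA k hk⟩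
    rw [YoungDiagram.mem_iff_lt_colLen] at hmem
    rw [Finset.mem_range]
    refine hmem.trans_le (YoungDiagram.colLen_anti _ _ _ ?_)
    rcases hy₀' k hk with h | h
    · rw [Biword.rad, h]
      exact hrad
    · rw [Biword.rad, h]
  obtain ⟨i, hi, j, hj, hij, hrij⟩ := Finset.exists_ne_map_eq_of_card_lt_of_maps_to
    (by rwa [Finset.card_range]) hmaps
  have hlet : x.1.letter i = x.1.letter j := (Biword.letter_eq_iff (hx i) (hx j)).2
    ⟨Fin.ext hrij, (hkA i hi).trans (hkA j hj).symm⟩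
  set τ : H n := signedPerm (Equiv.swap i j) 1 with hτ
  have hτx : τ • x = x := by
    refine Subtype.ext (Biword.smul_eq_of_ext fun k => ?_)
    rw [hτ, signedPerm_apply, Pi.one_apply, one_mul, Biword.ext_pos]
    change x.1.letter (Equiv.swap i j k) = x.1.letter k
    rcases eq_or_ne k i with rfl | hki
    · rw [Equiv.swap_apply_left, hlet]
    · rcases eq_or_ne k j with rfl | hkj
      · rw [Equiv.swap_apply_right, hlet]
      · rw [Equiv.swap_apply_of_ne_of_ne hki hkj]
  have hτsgn : (sgn τ : ℂ) = -1 := by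
    rw [hτ, sgn_signedPerm, Equiv.Perm.sign_swap hij]
    simp
  have hττ (y : X lam.transpose) : τ • τ • y = y := by
    rw [← mul_smul]
    convert one_smul (H n) y
    exact H.ext_one fun k => by simp [hτ]
  have hτR (y : X lam.transpose) (hy : y ∈ R) : τ • y ∈ R := by
    rw [hR] at hy ⊢
    have hlτ (k : Fin n) : (τ • y).1.letter k = y.1.letter (Equiv.swap i j k) := by
      have := Biword.letter_signedPerm_smul (Equiv.swap i j) y.1 (Equiv.swap i j k)
      rwa [Equiv.swap_apply_self] at this
    have hA (k : Fin n) : Equiv.swap i j k ∈ A ↔ k ∈ A := by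
      rcases eq_or_ne k i with rfl | hki
      · simp [hi, hj]
      · rcases eq_or_ne k j with rfl | hkj
        · simp [hi, hj]
        · rw [Equiv.swap_apply_of_ne_of_ne hki hkj]
    refine ⟨fun k hk => ?_, fun k hk => ?_⟩
    · rw [hlτ, Equiv.swap_apply_of_ne_of_ne (by rintro rfl; exact hk hi)
        (by rintro rfl; exact hk hj), hy.1 k hk]
    · rw [hlτ]
      exact hy.2 _ ((hA k).2 hk)
  have hsum : ∑ y ∈ R, spechtMatrix lam y x = ∑ y ∈ R, -spechtMatrix lam y x := by
    refine Finset.sum_nbij' (fun y => τ • y) (fun y => τ • y) hτR hτR (fun y _ => hττ y)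
      (fun y _ => hττ y) fun y _ => ?_
    conv_rhs => rw [← hτx, spechtMatrix_smul, hτsgn]
    ring
  rw [Finset.sum_neg_distrib] at hsum
  exact hne (self_eq_neg.1 hsum)

/-- A row of the Specht matrix, as a vector of the permutation module. -/
noncomputable def spechtRow {n : ℕ} (lam : Bipartition n) (y : X lam.transpose) : V lam :=
  Finsupp.equivFunOnFinite.symm (spechtMatrix lam y)

theorem spechtRow_apply {n : ℕ} (lam : Bipartition n) (y : X lam.transpose) (x : X lam) :
    spechtRow lam y x = spechtMatrix lam y x := rfl

/-- If `i < j` are the `a`-th occurrences of two letters, the first `a` occurrences of the former and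
those of the latter from the `a`-th on are together one more than all occurrences of the latter. These
are the positions that the Garnir relation rearranges. -/
theorem card_garnir {n : ℕ} {α : Type} [DecidableEq α] {f : Fin n → α} {i j : Fin n} (hij : i < j)
    (hf : f i ≠ f j) (hr : rank f i = rank f j) :
    (Finset.univ.filter fun k => (k ≤ i ∧ f k = f i) ∨ (j ≤ k ∧ f k = f j)).card =
      (Finset.univ.filter fun k => f k = f j).card + 1 := by
  rw [Finset.filter_or, Finset.card_union_of_disjoint]
  · have h1 : (Finset.univ.filter fun k => k ≤ i ∧ f k = f i) =
        insert i (Finset.univ.filter fun k => k < i ∧ f k = f i) := by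
      ext k
      simp only [Finset.mem_filter, Finset.mem_univ, true_and, Finset.mem_insert, le_iff_lt_or_eq]
      constructor
      · rintro ⟨h | h, h'⟩
        · exact .inr ⟨h, h'⟩
        · exact .inl h
      · rintro (rfl | ⟨h, h'⟩)
        · exact ⟨.inr rfl, rfl⟩
        · exact ⟨.inl h, h'⟩
    have h2 : (Finset.univ.filter fun k => f k = f j).card =
        (Finset.univ.filter fun k => k < j ∧ f k = f j).card +
          (Finset.univ.filter fun k => j ≤ k ∧ f k = f j).card := by
      rw [← Finset.card_filter_add_card_filter_not (s := Finset.univ.filter fun k => f k = f j)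
        (p := fun k => k < j), Finset.filter_filter, Finset.filter_filter]
      simp only [not_lt, and_comm]
    rw [h1, Finset.card_insert_of_notMem (by simp), h2]
    unfold rank at hr
    omega
  · rw [Finset.disjoint_filter]
    rintro k - ⟨_, h1⟩ ⟨_, h2⟩
    exact hf (h1.symm.trans h2)

/-- Straightening: the rows of the Specht matrix are spanned by those of the second words of the
standard pairs. The Garnir relation at a descent of `y` expresses the row `y` by rows of
lexicographically smaller words. -/
theorem spechtRow_mem_span_of_nonneg {n : ℕ} {lam : Bipartition n} (y : X lam.transpose)
    (hy : ∀ i, 0 ≤ y.1.phase i) :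
    spechtRow lam y ∈ Submodule.span ℂ (Set.range fun T : SYT lam => spechtRow lam T.y) := by
  classical
  induction h : toLex y.1.rad using WellFoundedLT.induction generalizing y with
  | ind r ih =>
  subst h
  rcases exists_standard_or_descent y hy with ⟨T, rfl⟩ | ⟨i, j, hij, hkij, hrad, hrank⟩
  · exact Submodule.subset_span ⟨T, rfl⟩
  have hlet : y.1.letter i ≠ y.1.letter j := fun h => hrad.ne' (congrArg Prod.fst h)
  set A : Finset (Fin n) := Finset.univ.filter fun k =>
    (k ≤ i ∧ y.1.letter k = y.1.letter i) ∨ (j ≤ k ∧ y.1.letter k = y.1.letter j) with hA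
  set R : Finset (X lam.transpose) := Finset.univ.filter fun y' =>
    (∀ k ∉ A, y'.1.letter k = y.1.letter k) ∧
      ∀ k ∈ A, y'.1.letter k = y.1.letter i ∨ y'.1.letter k = y.1.letter j with hR
  have hmemR (y' : X lam.transpose) : y' ∈ R ↔ (∀ k ∉ A, y'.1.letter k = y.1.letter k) ∧
      ∀ k ∈ A, y'.1.letter k = y.1.letter i ∨ y'.1.letter k = y.1.letter j := by simp [hR]
  have hmemA (k : Fin n) : k ∈ A ↔
      (k ≤ i ∧ y.1.letter k = y.1.letter i) ∨ (j ≤ k ∧ y.1.letter k = y.1.letter j) := by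
    simp [hA]
  have hcard : (lam.shape !y.1.kind j).colLen (y.1.rad j) < A.card := by
    rw [hA, card_garnir hij hlet hrank, Nat.lt_succ_iff]
    have h1 := card_letter_eq y hy (y.1.kind j) (y.1.rad j)
    rw [Bipartition.shape_transpose, YoungDiagram.rowLen_transpose] at h1
    rw [← h1]
    refine Finset.card_le_card fun k hk => ?_
    simp only [Finset.mem_filter, Finset.mem_univ, true_and] at hk ⊢
    have hj : y.1.letter j = (y.1.rad j, if y.1.kind j then 0 else 1) := by
      refine (letter_eq_iff_of_nonneg (hy j) ?_).2 ⟨rfl, ?_⟩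
      · cases y.1.kind j <;> simp
      · change y.1.kind j = _
        cases y.1.kind j <;> simp
    exact hk.trans hj.symm
  have hzero (x : X lam) : ∑ y' ∈ R, spechtMatrix lam y' x = 0 := by
    have h0 := sum_spechtMatrix_eq_zero A R y.1 _ _ hmemR hkij.symm hrad.le hcard
      (x.1.signChange • x) (by
        intro k
        rw [MulAction.orbit.coe_smul, x.1.signChange_smul]
        exact x.1.abs_nonneg k)
    simp only [spechtMatrix_signChange_right] at h0
    rw [← Finset.mul_sum] at h0
    exact (mul_eq_zero.1 h0).resolve_left (Int.cast_ne_zero.2 (sgn_ne_zero _))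
  have hyR : y ∈ R := (hmemR y).2 ⟨fun _ _ => rfl, fun k hk => by
    rcases (hmemA k).1 hk with h | h
    · exact .inl h.2
    · exact .inr h.2⟩
  have hnonneg (y' : X lam.transpose) (hy' : y' ∈ R) (k : Fin n) : 0 ≤ y'.1.phase k := by
    rw [Biword.phase]
    by_cases hk : k ∈ A
    · rcases ((hmemR y').1 hy').2 k hk with h | h
      · rw [h]
        exact hy i
      · rw [h]
        exact hy j
    · rw [((hmemR y').1 hy').1 k hk]
      exact hy k
  have hlt (y' : X lam.transpose) (hy' : y' ∈ R) (hne : y' ≠ y) :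
      toLex y'.1.rad < toLex y.1.rad := by
    obtain ⟨hoff, hon⟩ := (hmemR y').1 hy'
    have hkind (k : Fin n) : y'.1.kind k = y.1.kind k := by
      by_cases hk : k ∈ A
      · have h1 : y'.1.kind k = y.1.kind i := by
          rcases hon k hk with h | h
          · exact congrArg (fun l : Letter n => decide (l.2 = 0)) h
          · exact (congrArg (fun l : Letter n => decide (l.2 = 0)) h).trans hkij.symm
        rw [h1]
        rcases (hmemA k).1 hk with h | h
        · exact (congrArg (fun l : Letter n => decide (l.2 = 0)) h.2).symm
        · exact hkij.trans (congrArg (fun l : Letter n => decide (l.2 = 0)) h.2).symm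
      · exact congrArg (fun l : Letter n => decide (l.2 = 0)) (hoff k hk)
    by_contra hnlt
    rcases (not_lt.1 hnlt).eq_or_lt with heq | ⟨k, hk, hklt⟩
    · exact hne (Subtype.ext (Biword.eq_of_rad_eq (hnonneg y' hy') hy (toLex.injective heq.symm)
        hkind))
    change ∀ m < k, y.1.rad m = y'.1.rad m at hk
    change y.1.rad k < y'.1.rad k at hklt
    have hkA : k ∈ A := by
      by_contra hkA
      rw [Biword.rad, Biword.rad, hoff k hkA] at hklt
      exact lt_irrefl _ hklt
    have hrle : y'.1.rad k ≤ y.1.rad i := by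
      rcases hon k hkA with h | h
      · exact (congrArg Prod.fst h).le
      · exact (congrArg Prod.fst h).trans_le hrad.le
    have hjk : j ≤ k ∧ y.1.letter k = y.1.letter j := by
      rcases (hmemA k).1 hkA with h | h
      · exact absurd (congrArg Prod.fst h.2 : y.1.rad k = y.1.rad i) (hklt.trans_le hrle).ne
      · exact h
    have hk' : y'.1.letter k = y.1.letter i := by
      rcases hon k hkA with h | h
      · exact h
      · have h1 : y'.1.rad k = y.1.rad k := congrArg Prod.fst (h.trans hjk.2.symm)
        exact absurd h1 hklt.ne'
    -- beyond the first difference `y'` has one occurrence too many of the larger letter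
    have hcont : y.1.content (y.1.kind i) (y.1.rad i) < y'.1.content (y.1.kind i) (y.1.rad i) := by
      refine Finset.card_lt_card (Finset.ssubset_iff_of_subset (fun m hm => ?_) |>.2 ⟨k, ?_, ?_⟩)
      · simp only [Finset.mem_filter, Finset.mem_univ, true_and] at hm ⊢
        refine ⟨?_, (hkind m).trans hm.2⟩
        by_cases hmA : m ∈ A
        · have hmi : m ≤ i := by
            rcases (hmemA m).1 hmA with h | h
            · exact h.1
            · exact absurd (hm.1.symm.trans (congrArg Prod.fst h.2)) hrad.ne'
          rw [← hk m (hmi.trans_lt (hij.trans_le hjk.1)), hm.1]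
        · exact (congrArg Prod.fst (hoff m hmA)).trans hm.1
      · simp only [Finset.mem_filter, Finset.mem_univ, true_and]
        exact ⟨congrArg Prod.fst hk', congrArg (fun l : Letter n => decide (l.2 = 0)) hk'⟩
      · simp only [Finset.mem_filter, Finset.mem_univ, true_and]
        exact fun h => (hklt.trans_le hrle).ne h.1
    rw [content_eq_of_mem_orbit, content_eq_of_mem_orbit] at hcont
    exact lt_irrefl _ hcont
  have hrow : spechtRow lam y = -∑ y' ∈ R.erase y, spechtRow lam y' := by
    ext x
    have h := hzero x
    rw [← Finset.add_sum_erase R _ hyR] at h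
    rw [Finsupp.neg_apply, Finsupp.finsetSum_apply]
    exact eq_neg_of_add_eq_zero_left h
  rw [hrow]
  refine Submodule.neg_mem _ (Submodule.sum_mem _ fun y' hy' => ?_)
  rw [Finset.mem_erase] at hy'
  exact ih _ (hlt y' hy'.2 hy'.1) y' (hnonneg y' hy'.2) rfl

theorem spechtRow_mem_span {n : ℕ} {lam : Bipartition n} (y : X lam.transpose) :
    spechtRow lam y ∈ Submodule.span ℂ (Set.range fun T : SYT lam => spechtRow lam T.y) := by
  have h := spechtRow_mem_span_of_nonneg (y.1.signChange • y) fun i => by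
    rw [MulAction.orbit.coe_smul, y.1.signChange_smul]
    exact y.1.abs_nonneg i
  have hrow : spechtRow lam (y.1.signChange • y) =
      (sgn y.1.signChange : ℂ) • spechtRow lam y := by
    ext x
    exact spechtMatrix_signChange_left y x
  rw [hrow] at h
  exact (Submodule.smul_mem_iff _ (Int.cast_ne_zero.2 (sgn_ne_zero _))).1 h

/-! ### The basis of the Specht module -/

theorem spechtVector_eq_spechtRow {n : ℕ} {lam : Bipartition n} {x : X lam}
    {y : X lam.transpose} (h : Free x.1 y.1) : spechtVector lam x y = spechtRow lam y :=
  Finsupp.ext (spechtVector_apply h)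

theorem S_eq_span_spechtRow {n : ℕ} (lam : Bipartition n) :
    S lam = Submodule.span ℂ (Set.range fun T : SYT lam => spechtRow lam T.y) := by
  apply le_antisymm
  · rw [S, Submodule.span_le]
    rintro _ ⟨x, y, h, rfl⟩
    rw [spechtVector_eq_spechtRow h]
    exact spechtRow_mem_span y
  · rw [Submodule.span_le]
    rintro _ ⟨T, rfl⟩
    exact Submodule.subset_span ⟨T.x, T.y, T.free, spechtVector_eq_spechtRow T.free⟩

theorem rho_spechtRow {n : ℕ} (lam : Bipartition n) (σ : H n) (y : X lam.transpose) :
    rho lam σ (spechtRow lam y) = (sgn σ : ℂ) • spechtRow lam (σ • y) := by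
  have hσ : (sgn σ : ℂ) * sgn σ = 1 := by
    have h : IsUnit (sgn σ) := IsUnit.of_mul_eq_one (sgn σ⁻¹) (by
      rw [← sgn_mul, mul_inv_cancel, sgn_one])
    exact_mod_cast Int.isUnit_mul_self h
  ext x
  obtain ⟨x, rfl⟩ := MulAction.surjective σ x
  have h : rho lam σ (spechtRow lam y) (σ • x) = spechtRow lam y x :=
    Finsupp.mapDomain_apply (MulAction.injective σ) _ _
  rw [h, Finsupp.smul_apply, spechtRow_apply, spechtRow_apply, spechtMatrix_smul, smul_eq_mul,
    ← mul_assoc, hσ, one_mul]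

theorem rho_mem_S {n : ℕ} (lam : Bipartition n) (σ : H n) {v : V lam} (hv : v ∈ S lam) :
    rho lam σ v ∈ S lam := by
  rw [S_eq_span_spechtRow] at hv ⊢
  induction hv using Submodule.span_induction with
  | mem v hv =>
    obtain ⟨T, rfl⟩ := hv
    change rho lam σ (spechtRow lam T.y) ∈ _
    rw [rho_spechtRow]
    exact Submodule.smul_mem _ _ (spechtRow_mem_span _)
  | zero => simp
  | add v w _ _ hv hw =>
    rw [map_add]
    exact Submodule.add_mem _ hv hw
  | smul c v _ hv =>
    rw [map_smul]
    exact Submodule.smul_mem _ _ hv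

theorem linearIndependent_spechtRow {n : ℕ} (lam : Bipartition n) :
    LinearIndependent ℂ fun T : SYT lam => spechtRow lam T.y := by
  refine Fintype.linearIndependent_iff.2 fun c hc => ?_
  have h : Matrix.vecMul c (heart (spechtMatrix lam)) = 0 := by
    funext T
    have := DFunLike.congr_fun hc T.x
    rw [Finsupp.finsetSum_apply] at this
    exact this
  exact congrFun (Matrix.vecMul_injective_iff_isUnit.2 (isUnit_heart_spechtMatrix lam)
    (h.trans (Matrix.zero_vecMul _).symm))

theorem rho_spechtRow_apply {n : ℕ} (lam : Bipartition n) (σ : H n) (y : X lam.transpose)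
    (x : X lam) :
    rho lam σ (spechtRow lam y) x = (spechtMatrix lam * permMatrix lam σ) y x := by
  conv_lhs => rw [← Finsupp.univ_sum_single (spechtRow lam y), map_sum, Finsupp.finsetSum_apply]
  rw [Matrix.mul_apply]
  refine Finset.sum_congr rfl fun x' _ => ?_
  rw [← mul_one (spechtRow lam y x'), ← smul_eq_mul, ← Finsupp.smul_single, map_smul,
    Finsupp.smul_apply]
  rfl

/-- The basis of the Specht module that consists of the Specht vectors of the standard pairs. -/
noncomputable def spechtBasis {n : ℕ} (lam : Bipartition n) : Module.Basis (SYT lam) ℂ (S lam) :=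
  (Module.Basis.span (linearIndependent_spechtRow lam)).map
    (LinearEquiv.ofEq _ _ (S_eq_span_spechtRow lam).symm)

theorem spechtBasis_apply {n : ℕ} (lam : Bipartition n) (T : SYT lam) :
    (spechtBasis lam T : V lam) = spechtRow lam T.y := by
  simp [spechtBasis, Module.Basis.span_apply]

/-- The coordinates of `v_T.σ` in the basis are found by comparing the coefficients at the first words
of the standard pairs. -/
theorem toMatrix_transpose_mul_heart {n : ℕ} (lam : Bipartition n) (σ : H n)
    (hS : ∀ v ∈ S lam, rho lam σ v ∈ S lam) :
    (LinearMap.toMatrix (spechtBasis lam) (spechtBasis lam)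
        ((rho lam σ).restrict hS)).transpose * heart (spechtMatrix lam) =
      heart (spechtMatrix lam * permMatrix lam σ) := by
  ext T T'
  have h := congrArg (Subtype.val)
    ((spechtBasis lam).sum_repr ((rho lam σ).restrict hS (spechtBasis lam T)))
  rw [LinearMap.coe_restrict_apply, spechtBasis_apply, AddSubmonoidClass.coe_finsetSum] at h
  have h' := DFunLike.congr_fun h T'.x
  rw [rho_spechtRow_apply, Finsupp.finsetSum_apply] at h'
  rw [Matrix.mul_apply]
  refine Eq.trans (Finset.sum_congr rfl fun U _ => ?_) h'
  rw [Submodule.coe_smul, Finsupp.smul_apply, spechtBasis_apply, Matrix.transpose_apply,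
    LinearMap.toMatrix_apply]
  rfl

end Hyperoctahedral

theorem mainTheorem3 (n : ℕ) (lam : Hyperoctahedral.Bipartition n) :
    Function.Injective (Hyperoctahedral.SYT.x (lam := lam)) ∧
    Function.Injective (Hyperoctahedral.SYT.y (lam := lam)) ∧
    IsUnit (Hyperoctahedral.heart (Hyperoctahedral.spechtMatrix lam)) ∧
    ∃ (hS : ∀ σ : Hyperoctahedral.H n, ∀ v ∈ Hyperoctahedral.S lam,
          Hyperoctahedral.rho lam σ v ∈ Hyperoctahedral.S lam)
      (B : Module.Basis (Hyperoctahedral.SYT lam) ℂ (Hyperoctahedral.S lam)),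
      (∀ T, (B T : Hyperoctahedral.V lam) = Hyperoctahedral.spechtVector lam T.x T.y) ∧
      ∀ σ : Hyperoctahedral.H n,
        (LinearMap.toMatrix B B ((Hyperoctahedral.rho lam σ).restrict (hS σ))).transpose =
          Hyperoctahedral.heart
              (Hyperoctahedral.spechtMatrix lam * Hyperoctahedral.permMatrix lam σ) *
            (Hyperoctahedral.heart (Hyperoctahedral.spechtMatrix lam))⁻¹ := by
  open Hyperoctahedral in
  refine ⟨SYT.x_injective, SYT.y_injective, isUnit_heart_spechtMatrix lam,
    fun σ v hv => rho_mem_S lam σ hv, spechtBasis lam, fun T => ?_, fun σ => ?_⟩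
  · rw [spechtBasis_apply, spechtVector_eq_spechtRow T.free]
  · have hdet := (Matrix.isUnit_iff_isUnit_det _).1 (isUnit_heart_spechtMatrix lam)
    rw [← toMatrix_transpose_mul_heart, Matrix.mul_nonsing_inv_cancel_right _ _ hdet]
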